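/- **Setting.** Let $R=\bigoplus_{n\in\mathbb Z}R_n$ be a commutative Noetherian $\mathbb Z$-graded ring (for example a graded regular ring), let $f\in R_h$ be a homogeneous non-zero-divisor of degree $h$, and put $\overline R=R/(f)$. Let $S=R[w]$ be graded by the grading of $R$ and $\deg w=a\in\mathbb Z$, let $g\in wS$ be such that $F=f+wg$ is homogeneous of degree $h$, and put $\overline S=S/(F)$. For a Noetherian graded ring $A$ let $\operatorname{gr}A$ be the abelian category of finitely generated graded $A$-modules and degree-preserving maps, and let $D^b_{\rm sing}(\operatorname{gr}A)=D^b(\operatorname{gr}A)/D^{\rm perf}(\operatorname{gr}A)$ be the Verdier quotient by the full subcategory of objects isomorphic to bounded complexes of projective objects. $A(d)$ denotes the shift, $A(d)_n=A_{n+d}$. A *graded matrix factorization* of $f$ over $R$ consists of graded free modules $M_0=\bigoplus_{i=1}^mR(d_i)$, $M_1=\bigoplus_{i=1}^mR(e_i)$ and degree-preserving maps $\varphi:M_1\to M_0$, $\psi:M_0(-h)\to M_1$ with $\varphi\psi=f\cdot\mathrm{id}$ and $\psi\varphi=f\cdot\mathrm{id}$; $m$ is its rank. A morphism $(\varphi,\psi)\to(\varphi',\psi')$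 is a pair of degree-preserving maps $\alpha:M_0\to M_0'$, $\beta:M_1\to M_1'$ with $\alpha\varphi=\varphi'\beta$, $\beta\psi=\psi'\alpha$. Morphisms $(\alpha,\beta)$ and $(\alpha',\beta')$ are homotopic if there are degree-preserving maps $\xi:M_0\to M_1'$ and $\eta:M_1\to M_0'(-h)$ with $\alpha-\alpha'=\varphi'\xi+\eta\psi$ and $\beta-\beta'=\psi'\eta+\xi\varphi$. Let $\mathrm{Hmf}^{\rm gr}_R(f)$ be the category of graded matrix factorizations and homotopy classes of morphisms, and let $C_R:\mathrm{Hmf}^{\rm gr}_R(f)\to D^b_{\rm sing}(\operatorname{gr}\overline R)$ be the functor induced by $(\varphi,\psi)\mapsto\operatorname{coker}(\overline\varphi)$, where $\overline\varphi=\varphi\otimes_R\overline R$ (an equivalence when $R$ is a graded regular ring as in Orlov's theorem); $\mathrm{Hmf}^{\rm gr}_S(F)$ and $C_S$ are defined in the same way. Since $f$ is a non-zero-divisor, the exact functor $\operatorname{gr}\overline R\to\operatorname{gr}\overline S$ of restriction along the surjection $\overline S\to\overline S/(w)=\overline R$ preserves perfect complexes and so induces the push-forward $\Phi_{\rm sing}:D^b_{\rm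 sing}(\operatorname{gr}\overline R)\to D^b_{\rm sing}(\operatorname{gr}\overline S)$. For a graded matrix factorization $E=(\varphi,\psi)$ of $f$ over $R$ of rank $m$ with shifts $(d_i),(e_i)$, let $\widetilde E=(\widetilde\varphi,\widetilde\psi)$ be the graded matrix factorization of $F$ over $S$ of rank $2m$ $$\widetilde M_0=\bigoplus_iS(d_i)\oplus\bigoplus_iS(e_i+h-a),\qquad \widetilde M_1=\bigoplus_iS(e_i)\oplus\bigoplus_iS(d_i-a),$$ $$\widetilde\varphi=\begin{pmatrix}\varphi&w\\-g&\psi\end{pmatrix}:\widetilde M_1\to\widetilde M_0,\qquad \widetilde\psi=\begin{pmatrix}\psi&-w\\g&\varphi\end{pmatrix}:\widetilde M_0(-h)\to\widetilde M_1,$$ where $\varphi,\psi$ are regarded as matrices over $S$ through $R\hookrightarrow S$. **Proposition 3.1.** Under $C_R$ and $C_S$, the push-forward $\Phi_{\rm sing}$ corresponds to a functor on matrix factorizations that sends $E$ to $\widetilde E$. Precisely: 1. There is a functor $\Phi_{\rm Hmf}:\mathrm{Hmf}^{\rm gr}_R(f)\to\mathrm{Hmf}^{\rm gr}_S(F)$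 with $C_S\circ\Phi_{\rm Hmf}\cong\Phi_{\rm sing}\circ C_R$ and $\Phi_{\rm Hmf}(E)=\widetilde E$ for every graded matrix factorization $E$ of $f$. 2. Every functor $\Phi:\mathrm{Hmf}^{\rm gr}_R(f)\to\mathrm{Hmf}^{\rm gr}_S(F)$ with $C_S\circ\Phi\cong\Phi_{\rm sing}\circ C_R$ satisfies $\Phi(E)\cong\widetilde E$ in $\mathrm{Hmf}^{\rm gr}_S(F)$ for every $E$. -/

import Mathlib

open CategoryTheory CategoryTheory.Limits

universe w w' v v' u u'

namespace GrMF

section Gradings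

variable {M N : Type*} [AddCommGroup M] [AddCommGroup N]

/-- Projection to the homogeneous component of degree `i`. -/
noncomputable def gproj {ℳ : ℤ → AddSubgroup M} (h : DirectSum.IsInternal ℳ) (i : ℤ) : M →+ M :=
  ((ℳ i).subtype.comp (DFinsupp.evalAddMonoidHom i)).comp
    (AddEquiv.ofBijective (DirectSum.coeAddMonoidHom ℳ) h).symm.toAddMonoidHom

section

variable {ℳ : ℤ → AddSubgroup M} (h : DirectSum.IsInternal ℳ)

lemma gproj_mem (i : ℤ) (x : M) : gproj h i x ∈ ℳ i := by
  simp only [gproj, AddMonoidHom.comp_apply]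
  exact Subtype.property _

lemma gproj_of (i j : ℤ) {x : M} (hx : x ∈ ℳ i) : gproj h j x = if i = j then x else 0 := by
  have hs : (AddEquiv.ofBijective (DirectSum.coeAddMonoidHom ℳ) h).symm x =
      DirectSum.of (fun i => ℳ i) i ⟨x, hx⟩ := by
    rw [AddEquiv.symm_apply_eq]
    exact (DirectSum.coeAddMonoidHom_of ℳ i ⟨x, hx⟩).symm
  have : gproj h j x = ((AddEquiv.ofBijective (DirectSum.coeAddMonoidHom ℳ) h).symm x) j := rfl
  rw [this, hs]
  split_ifs with hij
  · subst hij
    simp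
  · rw [DirectSum.of_eq_of_ne _ _ _ (Ne.symm hij)]
    rfl

lemma gproj_same {i : ℤ} {x : M} (hx : x ∈ ℳ i) : gproj h i x = x := by
  rw [gproj_of h i i hx, if_pos rfl]

lemma homogeneous_induction {ℳ : ℤ → AddSubgroup M} (h : DirectSum.IsInternal ℳ)
    {p : M → Prop} (h0 : p 0) (hadd : ∀ x y, p x → p y → p (x + y))
    (hhom : ∀ i, ∀ x ∈ ℳ i, p x) (x : M) : p x := by
  obtain ⟨y, rfl⟩ := h.2 x
  induction y using DirectSum.induction_on with
  | zero => simpa using h0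
  | of i x => simpa using hhom i x x.2
  | add x y hx hy => simpa using hadd _ _ hx hy

lemma gproj_map {𝒩 : ℤ → AddSubgroup N} (h' : DirectSum.IsInternal 𝒩) (f : M →+ N)
    (hf : ∀ i, ∀ x ∈ ℳ i, f x ∈ 𝒩 i) (i : ℤ) (x : M) : f (gproj h i x) = gproj h' i (f x) := by
  induction x using homogeneous_induction h with
  | h0 => simp
  | hadd x y hx hy => simp [hx, hy]
  | hhom j x hx =>
    rw [gproj_of h j i hx, gproj_of h' j i (hf j x hx)]
    split_ifs <;> simp

end

lemma isInternal_of_proj {ℳ : ℤ → AddSubgroup M} (p : ℤ → M →+ M)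
    (h1 : ∀ i, ∀ x ∈ ℳ i, p i x = x) (h2 : ∀ i j, i ≠ j → ∀ x ∈ ℳ i, p j x = 0)
    (h3 : ∀ x : M, x ∈ ⨆ i, ℳ i) : DirectSum.IsInternal ℳ := by
  constructor
  · rw [injective_iff_map_eq_zero]
    intro y hy
    have key : ∀ (y : DirectSum ℤ fun i => ℳ i) (j : ℤ),
        p j (DirectSum.coeAddMonoidHom ℳ y) = y j := by
      intro y j
      induction y using DirectSum.induction_on with
      | zero => simp
      | of i x =>
        rw [DirectSum.coeAddMonoidHom_of]
        by_cases hij : i = j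
        · subst hij
          rw [h1 _ _ x.2]
          simp
        · rw [h2 i j hij _ x.2, DirectSum.of_eq_of_ne _ _ _ (Ne.symm hij)]
          rfl
      | add x y hx hy => simp [hx, hy]
    refine DFinsupp.ext fun j => Subtype.ext ?_
    rw [← key y j, hy]
    simp
  · intro x
    induction h3 x using AddSubgroup.iSup_induction' with
    | hp i x hx => exact ⟨DirectSum.of (fun i => ℳ i) i ⟨x, hx⟩, by simp⟩
    | h1 => exact ⟨0, by simp⟩
    | hadd x y _ _ hx hy =>
      obtain ⟨x, rfl⟩ := hx
      obtain ⟨y, rfl⟩ := hy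
      exact ⟨x + y, by simp⟩

open Classical in
/-- A subgroup stable under taking homogeneous components is graded by the induced family. -/
lemma isInternal_comap {ℳ : ℤ → AddSubgroup M} (h : DirectSum.IsInternal ℳ) (f : N →+ M)
    (hf : Function.Injective f) (hr : ∀ i x, gproj h i (f x) ∈ f.range) :
    DirectSum.IsInternal fun i => (ℳ i).comap f := by
  have hch : ∀ i x, ∃ y, f y = gproj h i (f x) := fun i x => hr i x
  choose q hq using hch
  refine isInternal_of_proj (fun i => AddMonoidHom.mk' (q i) fun x y => hf ?_) ?_ ?_ ?_
  · simp [hq]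
  · intro i x hx
    exact hf (by simpa [hq] using gproj_same h hx)
  · intro i j hij x hx
    refine hf ?_
    have : f x ∈ ℳ i := hx
    simp [hq, gproj_of h i j this, hij]
  · intro x
    obtain ⟨y, hy⟩ := h.2 (f x)
    have hx : x = ∑ i ∈ y.support, q i x := by
      refine hf ?_
      rw [map_sum, Finset.sum_congr rfl fun i _ => hq i x]
      have hg : ∀ i, gproj h i (f x) = y i := by
        intro i
        have : gproj h i (f x) =
          ((AddEquiv.ofBijective (DirectSum.coeAddMonoidHom ℳ) h).symm (f x)) i := rfl
        rw [this, ← hy]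
        congr 2
        exact (AddEquiv.ofBijective (DirectSum.coeAddMonoidHom ℳ) h).symm_apply_apply y
      rw [Finset.sum_congr rfl fun i _ => hg i, ← hy, DirectSum.coeAddMonoidHom_eq_dfinsuppSum]
      rfl
    rw [hx]
    refine sum_mem fun i _ => AddSubgroup.mem_iSup_of_mem i ?_
    change f (q i x) ∈ ℳ i
    rw [hq]
    exact gproj_mem h i _

/-- A quotient by a subgroup stable under homogeneous components is graded by the images. -/
lemma isInternal_map {ℳ : ℤ → AddSubgroup M} (h : DirectSum.IsInternal ℳ) (f : M →+ N)
    (hf : Function.Surjective f) (hr : ∀ i x, f x = 0 → f (gproj h i x) = 0) :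
    DirectSum.IsInternal fun i => (ℳ i).map f := by
  have hs : ∀ i x y, f x = f y → f (gproj h i x) = f (gproj h i y) := by
    intro i x y hxy
    rw [← sub_eq_zero, ← map_sub, ← map_sub]
    exact hr _ _ (by simp [hxy])
  have hq : ∀ i x, f (gproj h i (Function.surjInv hf (f x))) = f (gproj h i x) := fun i x =>
    hs i _ _ (Function.surjInv_eq hf _)
  refine isInternal_of_proj (fun i => AddMonoidHom.mk'
    (fun y => f (gproj h i (Function.surjInv hf y))) ?_) ?_ ?_ ?_
  · intro y z
    obtain ⟨y, rfl⟩ := hf y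
    obtain ⟨z, rfl⟩ := hf z
    rw [← map_add, hq, hq, hq]
    simp
  · rintro i _ ⟨x, hx, rfl⟩
    simp only [AddMonoidHom.mk'_apply]
    rw [hq, gproj_same h hx]
  · rintro i j hij _ ⟨x, hx, rfl⟩
    simp only [AddMonoidHom.mk'_apply]
    rw [hq, gproj_of h i j hx, if_neg hij, map_zero]
  · intro y
    obtain ⟨x, rfl⟩ := hf y
    induction x using homogeneous_induction h with
    | h0 => simp
    | hadd x y hx hy => rw [map_add]; exact add_mem hx hy
    | hhom i x hx => exact AddSubgroup.mem_iSup_of_mem i ⟨x, hx, rfl⟩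

end Gradings

section Rings

variable {A : Type u} [CommRing A]

/-- The grading of `A / (f)` induced by a grading of `A`. -/
def quotGrading (𝒜 : ℤ → AddSubgroup A) (f : A) : ℤ → AddSubgroup (A ⧸ Ideal.span {f}) :=
  fun n => (𝒜 n).map (Ideal.Quotient.mk (Ideal.span {f})).toAddMonoidHom

instance (𝒜 : ℤ → AddSubgroup A) [SetLike.GradedMonoid 𝒜] (f : A) :
    SetLike.GradedMonoid (quotGrading 𝒜 f) where
  one_mem := ⟨1, SetLike.GradedOne.one_mem, map_one (Ideal.Quotient.mk _)⟩
  mul_mem := by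
    rintro i j _ _ ⟨x, hx, rfl⟩ ⟨y, hy, rfl⟩
    exact ⟨x * y, SetLike.GradedMul.mul_mem hx hy, map_mul (Ideal.Quotient.mk _) _ _⟩

lemma gproj_mul (𝒜 : ℤ → AddSubgroup A) [SetLike.GradedMonoid 𝒜] (h𝒜 : DirectSum.IsInternal 𝒜)
    {f : A} {h : ℤ} (hf : f ∈ 𝒜 h) (i : ℤ) (x : A) :
    gproj h𝒜 i (f * x) = f * gproj h𝒜 (i - h) x := by
  induction x using homogeneous_induction h𝒜 with
  | h0 => simp
  | hadd x y hx hy => simp [mul_add, hx, hy]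
  | hhom j x hx =>
    rw [gproj_of h𝒜 (h + j) i (SetLike.GradedMul.mul_mem hf hx), gproj_of h𝒜 j _ hx]
    by_cases hij : h + j = i
    · rw [if_pos hij, if_pos (by lia)]
    · rw [if_neg hij, if_neg (by lia), mul_zero]

lemma isInternal_quotGrading (𝒜 : ℤ → AddSubgroup A) [SetLike.GradedMonoid 𝒜]
    (h𝒜 : DirectSum.IsInternal 𝒜) {f : A} {h : ℤ} (hf : f ∈ 𝒜 h) :
    DirectSum.IsInternal (quotGrading 𝒜 f) := by
  refine isInternal_map h𝒜 _ Ideal.Quotient.mk_surjective ?_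
  intro i x hx
  have hx' : x ∈ Ideal.span {f} := Ideal.Quotient.eq_zero_iff_mem.1 hx
  obtain ⟨y, rfl⟩ := Ideal.mem_span_singleton.1 hx'
  refine Ideal.Quotient.eq_zero_iff_mem.2 ?_
  rw [gproj_mul 𝒜 h𝒜 hf]
  exact Ideal.mem_span_singleton.2 ⟨_, rfl⟩

/-- The grading of the polynomial ring `A[w]` for which `w` has degree `a`. -/
def polyGrading (𝒜 : ℤ → AddSubgroup A) (a : ℤ) : ℤ → AddSubgroup (Polynomial A) := fun n =>
  { carrier := {p | ∀ k : ℕ, p.coeff k ∈ 𝒜 (n - k * a)}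
    zero_mem' := fun k => by simp [zero_mem]
    add_mem' := fun hp hq k => by simpa using add_mem (hp k) (hq k)
    neg_mem' := fun hp k => by simpa using hp k }

lemma mem_polyGrading {𝒜 : ℤ → AddSubgroup A} {a n : ℤ} {p : Polynomial A} :
    p ∈ polyGrading 𝒜 a n ↔ ∀ k : ℕ, p.coeff k ∈ 𝒜 (n - k * a) := Iff.rfl

lemma monomial_mem_polyGrading {𝒜 : ℤ → AddSubgroup A} {a n : ℤ} (k : ℕ) {x : A}
    (hx : x ∈ 𝒜 (n - k * a)) : Polynomial.monomial k x ∈ polyGrading 𝒜 a n := by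
  intro l
  rw [Polynomial.coeff_monomial]
  split_ifs with hkl
  · exact hkl ▸ hx
  · exact zero_mem _

lemma C_mem_polyGrading {𝒜 : ℤ → AddSubgroup A} {a n : ℤ} {x : A}
    (hx : x ∈ 𝒜 n) : Polynomial.C x ∈ polyGrading 𝒜 a n := by
  simpa using monomial_mem_polyGrading (𝒜 := 𝒜) (a := a) (n := n) 0 (x := x) (by simpa using hx)

instance (𝒜 : ℤ → AddSubgroup A) [SetLike.GradedMonoid 𝒜] (a : ℤ) :
    SetLike.GradedMonoid (polyGrading 𝒜 a) where
  one_mem := by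
    simpa using C_mem_polyGrading (𝒜 := 𝒜) (a := a) (SetLike.GradedOne.one_mem (A := 𝒜))
  mul_mem := by
    intro i j p q hp hq k
    rw [Polynomial.coeff_mul]
    refine sum_mem fun x hx => ?_
    have : (k : ℤ) = x.1 + x.2 := by
      have hx' : x.1 + x.2 = k := by simpa using hx
      exact_mod_cast hx'.symm
    have h := SetLike.GradedMul.mul_mem (A := 𝒜) (hp x.1) (hq x.2)
    rwa [show i - x.1 * a + (j - x.2 * a) = i + j - k * a by rw [this]; ring] at h

lemma X_mem_polyGrading {𝒜 : ℤ → AddSubgroup A} [SetLike.GradedMonoid 𝒜] {a : ℤ} :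
    (Polynomial.X : Polynomial A) ∈ polyGrading 𝒜 a a := by
  have h1 : (1 : A) ∈ 𝒜 (a - (1 : ℕ) * a) := by
    simpa using SetLike.GradedOne.one_mem (A := 𝒜)
  exact monomial_mem_polyGrading 1 h1

lemma isInternal_polyGrading (𝒜 : ℤ → AddSubgroup A) (h𝒜 : DirectSum.IsInternal 𝒜) (a : ℤ) :
    DirectSum.IsInternal (polyGrading 𝒜 a) := by
  let q : ℤ → Polynomial A → Polynomial A := fun n p =>
    ∑ k ∈ p.support, Polynomial.monomial k (gproj h𝒜 (n - k * a) (p.coeff k))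
  have hq : ∀ n p k, (q n p).coeff k = gproj h𝒜 (n - k * a) (p.coeff k) := by
    intro n p k
    simp only [q, Polynomial.finsetSum_coeff, Polynomial.coeff_monomial]
    rw [Finset.sum_ite_eq']
    split_ifs with hk
    · rfl
    · rw [Polynomial.notMem_support_iff.1 hk, map_zero]
  refine isInternal_of_proj (fun n => AddMonoidHom.mk' (q n) ?_) ?_ ?_ ?_
  · intro x y
    ext k
    simp [hq]
  · intro n p hp
    ext k
    simpa [hq] using gproj_same h𝒜 (hp k)
  · intro i j hij p hp
    ext k
    have : ¬ (i - k * a = j - k * a) := by lia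
    simp [hq, gproj_of h𝒜 _ _ (hp k), this]
  · intro p
    induction p using Polynomial.induction_on' with
    | add p q hp hq => exact add_mem hp hq
    | monomial n x =>
      induction x using homogeneous_induction h𝒜 with
      | h0 => simp
      | hadd x y hx hy => rw [map_add]; exact add_mem hx hy
      | hhom i x hx =>
        exact AddSubgroup.mem_iSup_of_mem (i + n * a)
          (monomial_mem_polyGrading n (by simpa using hx))

/-- The polynomial ring over a graded ring is a graded ring. -/
noncomputable instance (𝒜 : ℤ → AddSubgroup A) [GradedRing 𝒜] (a : ℤ) :
    GradedRing (polyGrading 𝒜 a) where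
  toDecomposition :=
    (isInternal_polyGrading 𝒜 (DirectSum.Decomposition.isInternal 𝒜) a).chooseDecomposition

end Rings

section GradedModules

variable {A : Type u} [CommRing A]

/-- A finitely generated graded module over the graded ring `(A, 𝒜)`. -/
structure GrModFG (𝒜 : ℤ → AddSubgroup A) where
  /-- The underlying module. -/
  carrier : Type u
  [addCommGroup : AddCommGroup carrier]
  [module : Module A carrier]
  /-- The homogeneous components. -/
  deg : ℤ → AddSubgroup carrier
  isInternal : DirectSum.IsInternal deg
  smul_mem : ∀ {i j : ℤ} {a : A} {x : carrier}, a ∈ 𝒜 i → x ∈ deg j → a • x ∈ deg (i + j)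
  finite : Module.Finite A carrier

namespace GrModFG

variable {𝒜 : ℤ → AddSubgroup A}

instance : CoeSort (GrModFG 𝒜) (Type u) := ⟨carrier⟩

attribute [instance] addCommGroup module finite

/-- A morphism of graded modules: a linear map of degree zero. -/
@[ext]
structure Hom (M N : GrModFG 𝒜) where
  /-- The underlying linear map. -/
  lin : M →ₗ[A] N
  map_deg : ∀ i, ∀ x ∈ M.deg i, lin x ∈ N.deg i

instance : Category (GrModFG 𝒜) where
  Hom M N := Hom M N
  id M := ⟨LinearMap.id, fun _ _ hx => hx⟩
  comp f g := ⟨g.lin.comp f.lin, fun i x hx => g.map_deg i _ (f.map_deg i x hx)⟩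

/-- The linear map underlying a morphism. -/
def lin {M N : GrModFG 𝒜} (f : M ⟶ N) : M →ₗ[A] N := Hom.lin f

lemma lin_mem {M N : GrModFG 𝒜} (f : M ⟶ N) {i : ℤ} {x : M} (hx : x ∈ M.deg i) :
    lin f x ∈ N.deg i := Hom.map_deg f i x hx

/-- Constructor for morphisms. -/
def ofLin {M N : GrModFG 𝒜} (f : M →ₗ[A] N) (hf : ∀ i, ∀ x ∈ M.deg i, f x ∈ N.deg i) : M ⟶ N :=
  Hom.mk f hf

@[simp] lemma lin_ofLin {M N : GrModFG 𝒜} (f : M →ₗ[A] N) (hf) : lin (ofLin f hf) = f := rfl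

@[ext] lemma hom_ext {M N : GrModFG 𝒜} {f g : M ⟶ N} (h : ∀ x, lin f x = lin g x) : f = g :=
  Hom.ext (LinearMap.ext h)

@[simp] lemma lin_id (M : GrModFG 𝒜) : lin (𝟙 M) = LinearMap.id := rfl

@[simp] lemma lin_comp {M N P : GrModFG 𝒜} (f : M ⟶ N) (g : N ⟶ P) :
    lin (f ≫ g) = (lin g).comp (lin f) := rfl

instance {M N : GrModFG 𝒜} : Zero (M ⟶ N) := ⟨ofLin 0 fun _ _ _ => zero_mem _⟩

instance {M N : GrModFG 𝒜} : Add (M ⟶ N) :=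
  ⟨fun f g => ofLin (lin f + lin g) fun _ _ hx => add_mem (lin_mem f hx) (lin_mem g hx)⟩

instance {M N : GrModFG 𝒜} : Neg (M ⟶ N) :=
  ⟨fun f => ofLin (-lin f) fun _ _ hx => neg_mem (lin_mem f hx)⟩

instance {M N : GrModFG 𝒜} : Sub (M ⟶ N) :=
  ⟨fun f g => ofLin (lin f - lin g) fun _ _ hx => sub_mem (lin_mem f hx) (lin_mem g hx)⟩

@[simp] lemma lin_zero {M N : GrModFG 𝒜} : lin (0 : M ⟶ N) = 0 := rfl
@[simp] lemma lin_add {M N : GrModFG 𝒜} (f g : M ⟶ N) : lin (f + g) = lin f + lin g := rfl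
@[simp] lemma lin_neg {M N : GrModFG 𝒜} (f : M ⟶ N) : lin (-f) = -lin f := rfl
@[simp] lemma lin_sub {M N : GrModFG 𝒜} (f g : M ⟶ N) : lin (f - g) = lin f - lin g := rfl

instance {M N : GrModFG 𝒜} : AddCommGroup (M ⟶ N) where
  add_assoc f g h := by ext x; simp [add_assoc]
  zero_add f := by ext x; simp
  add_zero f := by ext x; simp
  add_comm f g := by ext x; simp [add_comm]
  neg_add_cancel f := by ext x; simp
  sub_eq_add_neg f g := by ext x; simp [sub_eq_add_neg]
  nsmul := nsmulRec
  zsmul := zsmulRec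

instance : Preadditive (GrModFG 𝒜) where
  add_comp _ _ _ f g h := by ext x; simp
  comp_add _ _ _ f g h := by ext x; simp

/-- The homogeneous component of degree `i` of an element. -/
noncomputable def proj (M : GrModFG 𝒜) (i : ℤ) : M →+ M := gproj M.isInternal i

lemma proj_mem (M : GrModFG 𝒜) (i : ℤ) (x : M) : M.proj i x ∈ M.deg i := gproj_mem _ _ _

lemma proj_same (M : GrModFG 𝒜) {i : ℤ} {x : M} (hx : x ∈ M.deg i) : M.proj i x = x :=
  gproj_same _ hx

lemma lin_proj {M N : GrModFG 𝒜} (f : M ⟶ N) (i : ℤ) (x : M) :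
    lin f (M.proj i x) = N.proj i (lin f x) :=
  gproj_map M.isInternal N.isInternal (lin f).toAddMonoidHom (fun _ _ hx => lin_mem f hx) i x

section Zero

/-- The zero module. -/
def zeroObj (𝒜 : ℤ → AddSubgroup A) : GrModFG 𝒜 where
  carrier := PUnit
  deg _ := ⊥
  isInternal := by
    refine isInternal_of_proj (fun _ => 0) ?_ ?_ ?_
    · intro i x _; exact Subsingleton.elim _ _
    · intro i j _ x _; exact Subsingleton.elim _ _
    · intro x; rw [Subsingleton.elim x 0]; exact zero_mem _
  smul_mem _ _ := Subsingleton.elim _ _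
  finite := inferInstance

instance : HasZeroObject (GrModFG 𝒜) where
  zero := ⟨zeroObj 𝒜, by
    rw [IsZero.iff_id_eq_zero]
    ext x
    exact Subsingleton.elim (α := PUnit) _ _⟩

end Zero

section Prod

/-- The direct sum of two graded modules. -/
def prodObj (M N : GrModFG 𝒜) : GrModFG 𝒜 where
  carrier := M × N
  deg i := (M.deg i).prod (N.deg i)
  isInternal := by
    refine isInternal_of_proj (fun i => (M.proj i).prodMap (N.proj i)) ?_ ?_ ?_
    · rintro i ⟨x, y⟩ ⟨hx, hy⟩
      exact Prod.ext (M.proj_same hx) (N.proj_same hy)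
    · rintro i j hij ⟨x, y⟩ ⟨hx, hy⟩
      refine Prod.ext ?_ ?_
      · exact (gproj_of M.isInternal i j hx).trans (if_neg hij)
      · exact (gproj_of N.isInternal i j hy).trans (if_neg hij)
    · rintro ⟨x, y⟩
      rw [show ((x, y) : M × N) = (x, 0) + (0, y) by simp]
      refine add_mem ?_ ?_
      · induction x using homogeneous_induction M.isInternal with
        | h0 => exact zero_mem _
        | hadd x y hx hy =>
          rw [show ((x + y, 0) : M × N) = (x, 0) + (y, 0) by simp]
          exact add_mem hx hy
        | hhom i x hx => exact AddSubgroup.mem_iSup_of_mem i ⟨hx, zero_mem _⟩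
      · induction y using homogeneous_induction N.isInternal with
        | h0 => exact zero_mem _
        | hadd x y hx hy =>
          rw [show ((0, x + y) : M × N) = (0, x) + (0, y) by simp]
          exact add_mem hx hy
        | hhom i x hx => exact AddSubgroup.mem_iSup_of_mem i ⟨zero_mem _, hx⟩
  smul_mem ha hx := ⟨M.smul_mem ha hx.1, N.smul_mem ha hx.2⟩
  finite := inferInstance

/-- The direct sum as a biproduct. -/
def prodBicone (M N : GrModFG 𝒜) : BinaryBicone M N where
  pt := prodObj M N
  fst := ofLin (M := prodObj M N) (LinearMap.fst A M N) fun _ _ hx => hx.1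
  snd := ofLin (M := prodObj M N) (LinearMap.snd A M N) fun _ _ hx => hx.2
  inl := ofLin (N := prodObj M N) (LinearMap.inl A M N) fun _ _ hx => ⟨hx, zero_mem _⟩
  inr := ofLin (N := prodObj M N) (LinearMap.inr A M N) fun _ _ hx => ⟨zero_mem _, hx⟩
  inl_fst := rfl
  inl_snd := rfl
  inr_fst := rfl
  inr_snd := rfl

instance : HasBinaryBiproducts (GrModFG 𝒜) where
  has_binary_biproduct M N := HasBinaryBiproduct.mk
    ⟨prodBicone M N, isBinaryBilimitOfTotal _ (by
      refine hom_ext fun x => ?_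
      exact Prod.ext (add_zero _) (zero_add _))⟩

instance : HasFiniteProducts (GrModFG 𝒜) :=
  hasFiniteProducts_of_has_binary_and_terminal

end Prod

section Kernels

/-- A criterion for being a kernel. -/
noncomputable def isLimitOfExact {K M N : GrModFG 𝒜} (k : K ⟶ M) (f : M ⟶ N) (w : k ≫ f = 0)
    (hk : Function.Injective (lin k)) (hf : ∀ x, lin f x = 0 → ∃ y, lin k y = x) :
    IsLimit (KernelFork.ofι k w) := by
  have hl : ∀ {W : GrModFG 𝒜} (g : W ⟶ M), g ≫ f = 0 → ∃ l : W ⟶ K, l ≫ k = g := by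
    intro W g hg
    have hex : ∀ x, ∃ y, lin k y = lin g x := fun x =>
      hf _ (by simpa using LinearMap.congr_fun (congrArg lin hg) x)
    choose l hl using hex
    refine ⟨ofLin ⟨⟨l, fun x y => hk ?_⟩, fun a x => hk ?_⟩ ?_, ?_⟩
    · simp [hl]
    · simp [hl]
    · intro i x hx
      have h1 : lin k (K.proj i (l x)) = lin k (l x) := by
        rw [lin_proj, hl, M.proj_same (lin_mem g hx)]
      have h2 := hk h1
      change l x ∈ K.deg i
      rw [← h2]
      exact K.proj_mem _ _
    · ext x
      exact hl x
  exact KernelFork.IsLimit.ofι k w (fun g hg => (hl g hg).choose)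
    (fun g hg => (hl g hg).choose_spec)
    (fun g hg m hm => by
      ext x
      apply hk
      have h1 := LinearMap.congr_fun (congrArg lin hm) x
      have h2 := LinearMap.congr_fun (congrArg lin (hl g hg).choose_spec) x
      exact h1.trans h2.symm)

/-- A criterion for being a cokernel. -/
noncomputable def isColimitOfExact {M N C : GrModFG 𝒜} (f : M ⟶ N) (p : N ⟶ C) (w : f ≫ p = 0)
    (hp : Function.Surjective (lin p)) (hf : ∀ y, lin p y = 0 → ∃ x, lin f x = y) :
    IsColimit (CokernelCofork.ofπ p w) := by
  have hl : ∀ {W : GrModFG 𝒜} (g : N ⟶ W), f ≫ g = 0 → ∃ l : C ⟶ W, p ≫ l = g := by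
    intro W g hg
    have hz : ∀ y, lin p y = 0 → lin g y = 0 := by
      intro y hy
      obtain ⟨x, rfl⟩ := hf y hy
      exact LinearMap.congr_fun (congrArg lin hg) x
    have hz' : ∀ y z, lin p y = lin p z → lin g y = lin g z := by
      intro y z h
      rw [← sub_eq_zero, ← map_sub]
      exact hz _ (by simp [h])
    have hs : ∀ y, lin g (Function.surjInv hp (lin p y)) = lin g y := fun y =>
      hz' _ _ (Function.surjInv_eq hp _)
    refine ⟨ofLin ⟨⟨fun c => lin g (Function.surjInv hp c), ?_⟩, ?_⟩ ?_, ?_⟩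
    · intro x y
      obtain ⟨x, rfl⟩ := hp x
      obtain ⟨y, rfl⟩ := hp y
      rw [← map_add, hs, hs, hs, map_add]
    · intro a x
      obtain ⟨x, rfl⟩ := hp x
      simp only [RingHom.id_apply]
      rw [← map_smul, hs, hs, map_smul]
    · intro i c hc
      obtain ⟨y, rfl⟩ := hp c
      change lin g (Function.surjInv hp (lin p y)) ∈ W.deg i
      have h1 : lin p y = lin p (N.proj i y) := by rw [lin_proj, C.proj_same hc]
      rw [h1, hs]
      exact lin_mem g (N.proj_mem _ _)
    · ext y
      exact hs y
  exact CokernelCofork.IsColimit.ofπ p w (fun g hg => (hl g hg).choose)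
    (fun g hg => (hl g hg).choose_spec)
    (fun g hg m hm => by
      ext c
      obtain ⟨y, rfl⟩ := hp c
      have h1 := LinearMap.congr_fun (congrArg lin hm) y
      have h2 := LinearMap.congr_fun (congrArg lin (hl g hg).choose_spec) y
      exact h1.trans h2.symm)

section

variable {M N : GrModFG 𝒜} (f : M ⟶ N)

/-- The kernel of a morphism. -/
noncomputable def kerObj [IsNoetherianRing A] : GrModFG 𝒜 where
  carrier := LinearMap.ker (lin f)
  deg i := (M.deg i).comap (LinearMap.ker (lin f)).subtype.toAddMonoidHom
  isInternal := isInternal_comap M.isInternal _ Subtype.val_injective (by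
    rintro i ⟨x, hx⟩
    refine ⟨⟨M.proj i x, ?_⟩, rfl⟩
    rw [LinearMap.mem_ker] at hx ⊢
    rw [lin_proj, hx, map_zero])
  smul_mem ha hx := M.smul_mem ha hx
  finite := inferInstance

/-- The inclusion of the kernel. -/
noncomputable def kerι [IsNoetherianRing A] : kerObj f ⟶ M :=
  ofLin (M := kerObj f) (LinearMap.ker (lin f)).subtype fun _ _ hx => hx

lemma kerι_comp [IsNoetherianRing A] : kerι f ≫ f = 0 := by
  ext x
  exact LinearMap.mem_ker.1 x.2

lemma kerι_injective [IsNoetherianRing A] : Function.Injective (lin (kerι f)) :=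
  Subtype.val_injective

/-- `kerObj` is a kernel. -/
noncomputable def kerIsLimit [IsNoetherianRing A] :
    IsLimit (KernelFork.ofι (kerι f) (kerι_comp f)) :=
  isLimitOfExact _ _ _ (kerι_injective f) fun x hx => ⟨⟨x, hx⟩, rfl⟩

/-- The cokernel of a morphism. -/
noncomputable def cokerObj : GrModFG 𝒜 where
  carrier := N ⧸ LinearMap.range (lin f)
  deg i := (N.deg i).map (LinearMap.range (lin f)).mkQ.toAddMonoidHom
  isInternal := isInternal_map N.isInternal _ (Submodule.mkQ_surjective _) (by
    intro i x hx
    obtain ⟨y, rfl⟩ := (Submodule.Quotient.mk_eq_zero _).1 hx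
    refine (Submodule.Quotient.mk_eq_zero _).2 ⟨M.proj i y, ?_⟩
    exact lin_proj f i y)
  smul_mem := by
    rintro i j a _ ha ⟨x, hx, rfl⟩
    exact ⟨a • x, N.smul_mem ha hx, rfl⟩
  finite := inferInstance

/-- The projection to the cokernel. -/
noncomputable def cokerπ : N ⟶ cokerObj f :=
  ofLin (N := cokerObj f) (LinearMap.range (lin f)).mkQ fun _ x hx => ⟨x, hx, rfl⟩

lemma cokerπ_surjective : Function.Surjective (lin (cokerπ f)) :=
  Submodule.mkQ_surjective (LinearMap.range (lin f))

lemma cokerπ_eq_zero {y : N} : lin (cokerπ f) y = 0 ↔ ∃ x, lin f x = y :=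
  Submodule.Quotient.mk_eq_zero (LinearMap.range (lin f))

lemma comp_cokerπ : f ≫ cokerπ f = 0 := by
  ext x
  exact (cokerπ_eq_zero f).2 ⟨x, rfl⟩

/-- `cokerObj` is a cokernel. -/
noncomputable def cokerIsColimit :
    IsColimit (CokernelCofork.ofπ (cokerπ f) (comp_cokerπ f)) :=
  isColimitOfExact _ _ _ (cokerπ_surjective f) fun _ hy => (cokerπ_eq_zero f).1 hy

lemma injective_of_mono [IsNoetherianRing A] [Mono f] : Function.Injective (lin f) := by
  have h0 : kerι f = 0 := by
    rw [← cancel_mono f, kerι_comp, zero_comp]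
  rw [injective_iff_map_eq_zero]
  intro x hx
  exact LinearMap.congr_fun (congrArg lin h0) (⟨x, hx⟩ : LinearMap.ker (lin f))

lemma mono_of_injective (h : Function.Injective (lin f)) : Mono f where
  right_cancellation g g' hg := by
    ext x
    exact h (LinearMap.congr_fun (congrArg lin hg) x)

lemma surjective_of_epi [Epi f] : Function.Surjective (lin f) := by
  have h0 : cokerπ f = 0 := by
    rw [← cancel_epi f, comp_cokerπ, comp_zero]
  intro y
  rw [← LinearMap.mem_range]
  exact (cokerπ_eq_zero f).1 (LinearMap.congr_fun (congrArg lin h0) y)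

lemma epi_of_surjective (h : Function.Surjective (lin f)) : Epi f where
  left_cancellation g g' hg := by
    ext y
    obtain ⟨x, rfl⟩ := h y
    exact LinearMap.congr_fun (congrArg lin hg) x

end

instance : HasCokernels (GrModFG 𝒜) where
  has_colimit f := ⟨⟨_, cokerIsColimit f⟩⟩

instance [IsNoetherianRing A] : HasKernels (GrModFG 𝒜) where
  has_limit f := ⟨⟨_, kerIsLimit f⟩⟩

/-- Finitely generated graded modules over a Noetherian graded ring form an abelian category. -/
noncomputable instance [IsNoetherianRing A] : Abelian (GrModFG 𝒜) where
  normalMonoOfMono f _ := ⟨{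
    Z := cokerObj f
    g := cokerπ f
    w := comp_cokerπ f
    isLimit := isLimitOfExact _ _ _ (injective_of_mono f) fun _ hy => (cokerπ_eq_zero f).1 hy }⟩
  normalEpiOfEpi f _ := ⟨{
    W := kerObj f
    g := kerι f
    w := kerι_comp f
    isColimit := isColimitOfExact _ _ _ (surjective_of_epi f) fun y hy => ⟨⟨y, hy⟩, rfl⟩ }⟩

end Kernels

end GrModFG

end GradedModules

namespace GrModFG

section Free

variable {B : Type u} [CommRing B] {ℬ : ℤ → AddSubgroup B} [SetLike.GradedMonoid ℬ]
  (hℬ : DirectSum.IsInternal ℬ)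

/-- The graded free module `⨁ i, B(d i)`: a vector `v` has degree `n` if and only if
`v i ∈ B(d i)_n = B_{n + d i}` for all `i`. -/
noncomputable def free {ι : Type} [Fintype ι] [DecidableEq ι] (d : ι → ℤ) : GrModFG ℬ where
  carrier := ι → B
  deg n :=
    { carrier := {v | ∀ i, v i ∈ ℬ (n + d i)}
      zero_mem' := fun _ => zero_mem _
      add_mem' := fun hv hw i => add_mem (hv i) (hw i)
      neg_mem' := fun hv i => neg_mem (hv i) }
  isInternal := by
    refine isInternal_of_proj (fun n => AddMonoidHom.mk'
      (fun v i => gproj hℬ (n + d i) (v i)) ?_) ?_ ?_ ?_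
    · intro v w
      ext i
      simp
    · intro n v hv
      ext i
      exact gproj_same hℬ (hv i)
    · intro m n hmn v hv
      ext i
      refine (gproj_of hℬ _ _ (hv i)).trans (if_neg ?_)
      lia
    · intro v
      rw [← Finset.univ_sum_single v]
      refine sum_mem fun i _ => ?_
      generalize v i = x
      induction x using homogeneous_induction hℬ with
      | h0 => rw [Pi.single_zero]; exact zero_mem _
      | hadd x y hx hy => rw [Pi.single_add]; exact add_mem hx hy
      | hhom n x hx =>
        refine AddSubgroup.mem_iSup_of_mem (n - d i) ?_
        intro j
        by_cases hij : j = i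
        · subst hij
          simpa using hx
        · rw [Pi.single_eq_of_ne hij]
          exact zero_mem _
  smul_mem := by
    intro i j a v ha hv k
    have := SetLike.GradedMul.mul_mem (A := ℬ) ha (hv k)
    rwa [← add_assoc] at this
  finite := inferInstance

variable {ι κ : Type} [Fintype ι] [DecidableEq ι] [Fintype κ] [DecidableEq κ]

/-- The morphism `⨁ i, B(d i) ⟶ ⨁ k, B(d' k)` given by a matrix, the entry `(k, i)` of which is
homogeneous of degree `d' k - d i`. -/
noncomputable def freeMap {d : ι → ℤ} {d' : κ → ℤ} (m : Matrix κ ι B)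
    (hm : ∀ k i, m k i ∈ ℬ (d' k - d i)) : free hℬ d ⟶ free hℬ d' :=
  ofLin (M := free hℬ d) (N := free hℬ d') m.mulVecLin (by
    intro n v hv k
    change ∑ i, m k i * v i ∈ ℬ (n + d' k)
    refine sum_mem fun i _ => ?_
    have := SetLike.GradedMul.mul_mem (A := ℬ) (hm k i) (hv i)
    rwa [show d' k - d i + (n + d i) = n + d' k by ring] at this)

/-- The morphism out of a graded free module given by homogeneous elements. -/
noncomputable def freeDesc (d : ι → ℤ) (M : GrModFG ℬ) (x : ι → M)
    (hx : ∀ i, x i ∈ M.deg (-d i)) : free hℬ d ⟶ M :=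
  ofLin (M := free hℬ d) (Fintype.linearCombination B x) (by
    intro n v hv
    change ∑ i, (v : ι → B) i • x i ∈ M.deg n
    refine sum_mem fun i _ => ?_
    have := M.smul_mem (hv i) (hx i)
    rwa [add_neg_cancel_right] at this)

instance (d : ι → ℤ) [IsNoetherianRing B] : Projective (free hℬ d) where
  factors {E X} f e he := by
    have hs := surjective_of_epi e
    have hex : ∀ i, ∃ y ∈ E.deg (-d i),
        lin e y = lin f (Pi.single i (1 : B) : ι → B) := by
      intro i
      obtain ⟨y, hy⟩ := hs (lin f (Pi.single i (1 : B) : ι → B))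
      refine ⟨E.proj (-d i) y, E.proj_mem _ _, ?_⟩
      rw [lin_proj, hy]
      refine X.proj_same (lin_mem f ?_)
      intro j
      by_cases hij : j = i
      · subst hij
        rw [Pi.single_eq_same, neg_add_cancel]
        exact SetLike.GradedOne.one_mem
      · rw [Pi.single_eq_of_ne hij]
        exact zero_mem _
    choose y hy hy' using hex
    refine ⟨freeDesc hℬ d E y hy, hom_ext fun v => ?_⟩
    have h1 : lin (freeDesc hℬ d E y hy) v = ∑ i, (v : ι → B) i • y i :=
      Fintype.linearCombination_apply ..
    have h2 : (v : ι → B) = ∑ i, (v : ι → B) i • (Pi.single i (1 : B) : ι → B) :=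
      pi_eq_sum_univ' v
    rw [lin_comp, LinearMap.comp_apply, h1, map_sum]
    simp only [map_smul, hy']
    conv_rhs => rw [h2]
    exact (map_sum (lin f) _ _ |>.trans (Finset.sum_congr rfl fun i _ => map_smul (lin f) _ _)).symm

/-- Every finitely generated graded module is a quotient of a graded free module. -/
lemma exists_free_epi [IsNoetherianRing B] (M : GrModFG ℬ) :
    ∃ (n : ℕ) (d : Fin n → ℤ) (p : free hℬ d ⟶ M), Epi p := by
  obtain ⟨s, hs⟩ := M.finite.fg_top
  let t : Set M := {x | ∃ i, x ∈ M.deg i}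
  have ht : Submodule.span B t = ⊤ := by
    rw [eq_top_iff]
    intro x _
    induction x using homogeneous_induction M.isInternal with
    | h0 => exact zero_mem _
    | hadd x y hx hy => exact add_mem (hx trivial) (hy trivial)
    | hhom i x hx => exact Submodule.subset_span ⟨i, hx⟩
  obtain ⟨t', ht', hspan⟩ := (Submodule.fg_span_iff_fg_span_finset_subset t).1
    (ht ▸ M.finite.fg_top)
  rw [ht] at hspan
  let e := t'.equivFin
  have hex : ∀ k, ∃ i, ((e.symm k : t') : M) ∈ M.deg i := fun k => ht' (e.symm k).2
  choose i hi using hex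
  let p := freeDesc hℬ (fun k => -i k) M (fun k => ((e.symm k : t') : M))
    (fun k => by simpa using hi k)
  refine ⟨t'.card, fun k => -i k, p, epi_of_surjective p ?_⟩
  have hr : LinearMap.range (Fintype.linearCombination B fun k => ((e.symm k : t') : M)) = ⊤ := by
    rw [Fintype.range_linearCombination, hspan]
    congr 1
    ext x
    constructor
    · rintro ⟨k, rfl⟩
      exact (e.symm k).2
    · intro hx
      exact ⟨e ⟨x, hx⟩, by simp⟩
  exact LinearMap.range_eq_top.1 hr

lemma enoughProjectives {B : Type u} [CommRing B] {ℬ : ℤ → AddSubgroup B}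
    [SetLike.GradedMonoid ℬ] (hℬ : DirectSum.IsInternal ℬ) [IsNoetherianRing B] :
    EnoughProjectives (GrModFG ℬ) where
  presentation M := by
    obtain ⟨n, d, p, hp⟩ := exists_free_epi hℬ M
    exact ⟨{ p := free hℬ d, f := p, projective := inferInstance, epi := hp }⟩

end Free

section Restriction

variable {A B : Type u} [CommRing A] [CommRing B] {𝒜 : ℤ → AddSubgroup A} {ℬ : ℤ → AddSubgroup B}

/-- Restriction of scalars along a surjective homomorphism of graded rings, on objects. -/
def resObj (π : A →+* B) (hπ : ∀ i, ∀ a ∈ 𝒜 i, π a ∈ ℬ i) (hs : Function.Surjective π)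
    (M : GrModFG ℬ) : GrModFG 𝒜 :=
  letI : Module A M := Module.compHom M π
  { carrier := M
    deg := M.deg
    isInternal := M.isInternal
    smul_mem := fun ha hx => M.smul_mem (hπ _ _ ha) hx
    finite := by
      let : Algebra A B := π.toAlgebra
      have : IsScalarTower A B M := ⟨fun a b m => mul_smul (π a) b m⟩
      have : Module.Finite A B := Module.Finite.of_surjective (Algebra.linearMap A B) hs
      exact Module.Finite.trans B M }

/-- The functor sending a graded `B`-module to the same module considered as a graded `A`-module
through a surjective homomorphism of graded rings `A → B`. -/
def res (π : A →+* B) (hπ : ∀ i, ∀ a ∈ 𝒜 i, π a ∈ ℬ i) (hs : Function.Surjective π) :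
    GrModFG ℬ ⥤ GrModFG 𝒜 where
  obj M := resObj π hπ hs M
  map {M N} f := ofLin (M := resObj π hπ hs M) (N := resObj π hπ hs N)
    { toFun := lin f
      map_add' := map_add (lin f)
      map_smul' := fun a x => (lin f).map_smul (π a) x } (fun _ _ hx => lin_mem f hx)

variable (π : A →+* B) (hπ : ∀ i, ∀ a ∈ 𝒜 i, π a ∈ ℬ i) (hs : Function.Surjective π)

instance : (res π hπ hs).Additive where

instance [IsNoetherianRing A] [IsNoetherianRing B] : PreservesFiniteLimits (res π hπ hs) := by
  have : ∀ {X Y : GrModFG ℬ} (f : X ⟶ Y), PreservesLimit (parallelPair f 0) (res π hπ hs) :=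
    fun f => preservesLimit_of_preserves_limit_cone (kerIsLimit f)
      ((KernelFork.isLimitMapConeEquiv _ _).symm
        (isLimitOfExact _ _ (KernelFork.map_condition _ _) (kerι_injective f) fun x hx => ⟨⟨x, hx⟩, rfl⟩))
  exact Functor.preservesFiniteLimits_of_preservesKernels _

instance [IsNoetherianRing A] [IsNoetherianRing B] : PreservesFiniteColimits (res π hπ hs) := by
  have : ∀ {X Y : GrModFG ℬ} (f : X ⟶ Y), PreservesColimit (parallelPair f 0) (res π hπ hs) :=
    fun f => preservesColimit_of_preserves_colimit_cocone (cokerIsColimit f)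
      ((CokernelCofork.isColimitMapCoconeEquiv _ _).symm
        (isColimitOfExact _ _ (CokernelCofork.map_condition _ _) (cokerπ_surjective f) fun _ hy => (cokerπ_eq_zero f).1 hy))
  exact Functor.preservesFiniteColimits_of_preservesCokernels _

end Restriction

end GrModFG

section

variable {C : Type u} [Category.{v} C] [Abelian C]
variable {D : Type u'} [Category.{v'} D] [Abelian D] [HasDerivedCategory.{w'} D]
variable (F : C ⥤ D) [F.Additive] [PreservesFiniteLimits F] [PreservesFiniteColimits F]

lemma devissage (P : ObjectProperty (DerivedCategory D)) [P.IsTriangulated]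
    [P.IsClosedUnderIsomorphisms]
    (hP : ∀ X : C, Projective X → P ((DerivedCategory.singleFunctor D 0).obj (F.obj X)))
    (n : ℕ) : ∀ (K : CochainComplex C ℤ) (a b : ℤ), b < a + n → K.IsStrictlyGE a →
      K.IsStrictlyLE b → (∀ i, Projective (K.X i)) →
      P (DerivedCategory.Q.obj ((F.mapHomologicalComplex _).obj K)) := by
  induction n with
  | zero =>
    intro K a b hab ha hb _
    have hK : IsZero K := by
      rw [IsZero.iff_id_eq_zero]
      ext i
      by_cases hi : i < a
      · exact (K.isZero_of_isStrictlyGE a i hi).eq_of_src _ _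
      · exact (K.isZero_of_isStrictlyLE b i (by lia)).eq_of_src _ _
    exact P.prop_of_isZero (DerivedCategory.Q.map_isZero (Functor.map_isZero _ hK))
  | succ n ih =>
    intro K a b hab ha hb hK
    let φ : K ⟶ (HomologicalComplex.single C (ComplexShape.up ℤ) a).obj (K.X a) :=
      HomologicalComplex.mkHomToSingle (𝟙 _) (fun i hi =>
        (K.isZero_of_isStrictlyGE a i (by simp at hi; lia)).eq_of_src _ _)
    have hφa : φ.f a = (HomologicalComplex.singleObjXSelf _ a (K.X a)).inv := by
      simp [φ]
    have hi0 : ∀ i, i ≠ a → IsZero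
        (((HomologicalComplex.single C (ComplexShape.up ℤ) a).obj (K.X a)).X i) := fun i hi =>
      HomologicalComplex.isZero_single_obj_X _ _ _ _ hi
    have hepi : Epi φ := by
      refine HomologicalComplex.epi_of_epi_f _ fun i => ?_
      by_cases hi : i = a
      · subst hi
        rw [hφa]
        infer_instance
      · exact ⟨fun _ _ _ => (hi0 i hi).eq_of_src _ _⟩
    let e : ∀ i, (kernel φ).X i ≅ kernel (φ.f i) := fun i =>
      PreservesKernel.iso (HomologicalComplex.eval C (ComplexShape.up ℤ) i) φ
    have hka : IsZero ((kernel φ).X a) := by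
      have : Mono (φ.f a) := by
        rw [hφa]
        infer_instance
      exact (isZero_kernel_of_mono (φ.f a)).of_iso (e a)
    have hki : ∀ i, i ≠ a → Nonempty ((kernel φ).X i ≅ K.X i) := fun i hi =>
      ⟨e i ≪≫ kernelIsoOfEq ((hi0 i hi).eq_of_tgt _ 0) ≪≫ kernelZeroIsoSource⟩
    have hS : (ShortComplex.mk (kernel.ι φ) φ (kernel.condition φ)).ShortExact :=
      { exact := ShortComplex.exact_kernel φ }
    have hT := DerivedCategory.triangleOfSES_distinguished
      (hS.map_of_exact (F.mapHomologicalComplex (ComplexShape.up ℤ)))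
    refine P.ext_of_isTriangulatedClosed₂ _ hT ?_ ?_
    · refine ih (kernel φ) (a + 1) b (by push_cast at hab; lia) ?_ ?_ ?_
      · rw [CochainComplex.isStrictlyGE_iff]
        intro i hi
        by_cases h : i = a
        · exact h ▸ hka
        · exact (K.isZero_of_isStrictlyGE a i (by lia)).of_iso (hki i h).some
      · rw [CochainComplex.isStrictlyLE_iff]
        intro i hi
        by_cases h : i = a
        · exact h ▸ hka
        · exact (K.isZero_of_isStrictlyLE b i (by lia)).of_iso (hki i h).some
      · intro i
        by_cases h : i = a
        · exact h ▸ hka.projective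
        · exact Projective.of_iso (hki i h).some.symm (hK i)
    · have h1 := P.le_shift (-a) _ (hP _ (hK a))
      refine P.prop_of_iso ?_ h1
      exact ((DerivedCategory.singleFunctors D).shiftIso (-a) a 0 (by lia)).app _ ≪≫
        DerivedCategory.Q.mapIso
          ((HomologicalComplex.singleMapHomologicalComplex F (ComplexShape.up ℤ) a).app _).symm

end

section DerivedSing

variable (C : Type u) [Category.{v} C] [Abelian C] [HasDerivedCategory.{w} C]

/-- The bounded derived category `D^b(C)`. -/
abbrev Db : Type _ :=
  (DerivedCategory.TStructure.t : Triangulated.TStructure (DerivedCategory C)).bounded.FullSubcategory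

/-- An object of the derived category is perfect if it is isomorphic to a bounded complex of
projective objects. -/
def perfD : ObjectProperty (DerivedCategory C) := fun X =>
  ∃ (K : CochainComplex C ℤ) (a b : ℤ), K.IsStrictlyGE a ∧ K.IsStrictlyLE b ∧
    (∀ n, Projective (K.X n)) ∧ Nonempty (X ≅ DerivedCategory.Q.obj K)

instance : (perfD C).IsClosedUnderIsomorphisms where
  of_iso := by
    rintro X Y e ⟨K, a, b, ha, hb, hK, ⟨i⟩⟩
    exact ⟨K, a, b, ha, hb, hK, ⟨e.symm ≪≫ i⟩⟩

instance : (perfD C).IsStableUnderShift ℤ where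
  isStableUnderShiftBy n :=
    { le_shift := by
        rintro X ⟨K, a, b, ha, hb, hK, ⟨i⟩⟩
        refine ⟨(shiftFunctor _ n).obj K, a - n, b - n, K.isStrictlyGE_shift a n _ (by lia),
          K.isStrictlyLE_shift b n _ (by lia), fun m => hK (m + n), ⟨?_⟩⟩
        exact (shiftFunctor _ n).mapIso i ≪≫ (DerivedCategory.Q.commShiftIso n).symm.app K }

instance : (perfD C).IsTriangulatedClosed₃ := .mk' (by
  rintro T hT ⟨K, a, b, ha, hb, hK, ⟨i⟩⟩ ⟨L, a', b', ha', hb', hL, ⟨j⟩⟩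
  have := CochainComplex.isKProjective_of_projective K b
  obtain ⟨φ', hφ'⟩ := (CochainComplex.IsKProjective.Qh_map_bijective K
    ((HomotopyCategory.quotient _ _).obj L)).2
      ((DerivedCategory.quotientCompQhIso C).hom.app K ≫ i.inv ≫ T.mor₁ ≫ j.hom ≫
        (DerivedCategory.quotientCompQhIso C).inv.app L)
  obtain ⟨φ, rfl⟩ := (HomotopyCategory.quotient C (ComplexShape.up ℤ)).map_surjective φ'
  have hφ : T.mor₁ ≫ j.hom = i.hom ≫ DerivedCategory.Q.map φ := by
    rw [← cancel_mono ((DerivedCategory.quotientCompQhIso C).inv.app L), Category.assoc,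
      Category.assoc, DerivedCategory.quotientCompQhIso_inv_naturality, hφ']
    simp
  refine ⟨CochainComplex.mappingCone φ, min (a - 1) a', max b b', ?_, ?_, ?_, ⟨?_⟩⟩
  · rw [CochainComplex.isStrictlyGE_iff]
    intro n hn
    rw [CochainComplex.mappingCone.isZero_X_iff]
    exact ⟨K.isZero_of_isStrictlyGE a _ (by lia), L.isZero_of_isStrictlyGE a' _ (by lia)⟩
  · rw [CochainComplex.isStrictlyLE_iff]
    intro n hn
    rw [CochainComplex.mappingCone.isZero_X_iff]
    exact ⟨K.isZero_of_isStrictlyLE b _ (by lia), L.isZero_of_isStrictlyLE b' _ (by lia)⟩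
  · intro n
    have h1 := hK (n + 1)
    have h2 := hL n
    exact Projective.of_iso (HomologicalComplex.homotopyCofiber.XIsoBiprod φ n (n + 1) rfl).symm
      inferInstance
  · exact Pretriangulated.Triangle.π₃.mapIso (Pretriangulated.isoTriangleOfIso₁₂ _ _ hT
      (DerivedCategory.mappingCone_triangle_distinguished φ) i j hφ))

instance : (perfD C).IsTriangulated where
  exists_zero := by
    obtain ⟨Z, hZ⟩ := HasZeroObject.zero (C := CochainComplex C ℤ)
    have hX : ∀ n, IsZero (Z.X n) := fun n =>
      (HomologicalComplex.eval C (ComplexShape.up ℤ) n).map_isZero hZ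
    exact ⟨DerivedCategory.Q.obj Z, DerivedCategory.Q.map_isZero hZ, Z, 0, 0,
      (CochainComplex.isStrictlyGE_iff _ _).2 fun _ _ => hX _,
      (CochainComplex.isStrictlyLE_iff _ _).2 fun _ _ => hX _,
      fun n => (hX n).projective, ⟨Iso.refl _⟩⟩
  toIsTriangulatedClosed₂ := .of_isTriangulatedClosed₃

lemma perfD_single (X : C) [Projective X] (n : ℤ) :
    perfD C ((DerivedCategory.singleFunctor C n).obj X) := by
  refine ⟨(CochainComplex.singleFunctor C n).obj X, n, n, inferInstance, inferInstance, ?_,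
    ⟨(DerivedCategory.singleFunctorIsoCompQ C n).app X⟩⟩
  intro m
  by_cases h : m = n
  · exact Projective.of_iso (HomologicalComplex.singleObjXIsoOfEq _ n X m h).symm inferInstance
  · have := HomologicalComplex.isZero_single_obj_X (ComplexShape.up ℤ) n X m h
    exact this.projective

/-- The full subcategory of perfect complexes in `D^b(C)`: objects isomorphic to bounded complexes
of projective objects. -/
def perf : ObjectProperty (Db C) := (perfD C).inverseImage (ObjectProperty.ι _)

instance : (perf C).IsTriangulated := by
  unfold perf
  infer_instance

instance : (perf C).IsClosedUnderIsomorphisms := by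
  unfold perf
  infer_instance

/-- The stable derived category `D^b_sing(C) = D^b(C) / D^perf(C)`, a Verdier quotient: the
localization of `D^b(C)` at the morphisms the cone of which is perfect. -/
abbrev Dsing : Type _ := (perf C).trW.Localization

/-- The quotient functor `D^b(C) ⥤ D^b_sing(C)`. -/
noncomputable abbrev toDsing : Db C ⥤ Dsing C := (perf C).trW.Q

/-- An object of `C` as a complex concentrated in degree zero, in `D^b(C)`. -/
noncomputable def singleDb : C ⥤ Db C :=
  ObjectProperty.lift _ (DerivedCategory.singleFunctor C 0) fun _ =>
    ⟨⟨0, inferInstance⟩, ⟨0, inferInstance⟩⟩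

instance : (singleDb C).Additive where
  map_add {X Y f g} := by
    apply (ObjectProperty.ι _).map_injective
    exact (DerivedCategory.singleFunctor C 0).map_add

lemma isZero_toDsing (X : Db C) (hX : perf C X) : IsZero ((toDsing C).obj X) := by
  obtain ⟨Z, hZ⟩ := HasZeroObject.zero (C := Db C)
  have hf : (perf C).trW (0 : Z ⟶ X) := by
    refine ⟨X, 𝟙 X, 0, ?_, hX⟩
    refine Pretriangulated.isomorphic_distinguished _
      (Pretriangulated.contractible_distinguished₁ X) _ ?_
    exact Pretriangulated.Triangle.isoMk _ _ hZ.isoZero (Iso.refl _) (Iso.refl _)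
      (hZ.eq_of_src _ _) ((Category.comp_id _).trans (Category.id_comp _).symm)
      (zero_comp.trans comp_zero.symm)
  have : IsIso ((toDsing C).map (0 : Z ⟶ X)) := Localization.inverts _ _ _ hf
  exact ((toDsing C).map_isZero hZ).of_iso (asIso ((toDsing C).map (0 : Z ⟶ X))).symm

variable {C}

section

variable {D : Type u'} [Category.{v'} D] [Abelian D] [HasDerivedCategory.{w'} D]
variable (F : C ⥤ D) [F.Additive] [PreservesFiniteLimits F] [PreservesFiniteColimits F]

/-- The functor `D^b(C) ⥤ D^b(D)` induced by an exact functor. -/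
noncomputable def mapDb : Db C ⥤ Db D :=
  ObjectProperty.lift _ (ObjectProperty.ι _ ⋙ F.mapDerivedCategory) (by
    rintro ⟨X, ⟨a, ⟨K, e, hK⟩⟩, ⟨b, ⟨L, e', hL⟩⟩⟩
    refine ⟨⟨a, ⟨(F.mapHomologicalComplex _).obj K,
      F.mapDerivedCategory.mapIso e ≪≫ F.mapDerivedCategoryFactors.app K, ?_⟩⟩,
      ⟨b, ⟨(F.mapHomologicalComplex _).obj L,
      F.mapDerivedCategory.mapIso e' ≪≫ F.mapDerivedCategoryFactors.app L, ?_⟩⟩⟩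
    · rw [CochainComplex.isStrictlyGE_iff]
      exact fun i hi => F.map_isZero (K.isZero_of_isStrictlyGE a i hi)
    · rw [CochainComplex.isStrictlyLE_iff]
      exact fun i hi => F.map_isZero (L.isZero_of_isStrictlyLE b i hi))

noncomputable instance : (mapDb F).CommShift ℤ := by
  unfold mapDb
  infer_instance

instance : (mapDb F).IsTriangulated := by
  unfold mapDb
  infer_instance

lemma perf_mapDb (hF : ∀ X : C, Projective X → HasProjectiveDimensionLT (F.obj X) 2)
    [EnoughProjectives D] (X : Db C) (hX : perf C X) : perf D ((mapDb F).obj X) := by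
  obtain ⟨K, a, b, ha, hb, hK, ⟨e⟩⟩ := hX
  have h1 : perfD D (DerivedCategory.Q.obj ((F.mapHomologicalComplex _).obj K)) := by
    refine devissage F (perfD D) ?_ (b - a + 1).toNat K a b (by lia) ha hb hK
    intro X hX
    have h2 := hF X hX
    have hS : (ShortComplex.mk (kernel.ι (Projective.π (F.obj X))) (Projective.π (F.obj X))
        (kernel.condition _)).ShortExact := { exact := ShortComplex.exact_kernel _ }
    have h3 := hS.hasProjectiveDimensionLT_X₁ 1 inferInstance h2
    have h4 := projective_iff_hasProjectiveDimensionLT_one.2 h3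
    exact (perfD D).ext_of_isTriangulatedClosed₃ _ hS.singleTriangle_distinguished
      (perfD_single D _ 0) (perfD_single D _ 0)
  exact (perfD D).prop_of_iso
    (F.mapDerivedCategoryFactors.symm.app K ≪≫ F.mapDerivedCategory.mapIso e.symm) h1

lemma mapDb_inverts (hF : ∀ X : C, Projective X → HasProjectiveDimensionLT (F.obj X) 2)
    [EnoughProjectives D] : (perf C).trW.IsInvertedBy (mapDb F ⋙ toDsing D) := by
  rintro X Y f ⟨Z, g, h, hT, hZ⟩
  refine Localization.inverts (toDsing D) (perf D).trW _ ?_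
  exact ObjectProperty.trW.mk _ ((mapDb F).map_distinguished _ hT) (perf_mapDb F hF _ hZ)

end

end DerivedSing

/-- The model of the derived category that is used for graded modules. -/
noncomputable instance {A : Type u} [CommRing A] [IsNoetherianRing A] (𝒜 : ℤ → AddSubgroup A) :
    HasDerivedCategory (GrModFG 𝒜) :=
  HasDerivedCategory.standard _

section MatFac

variable {A : Type u} [CommRing A]

/-- A graded matrix factorization of `f`, an element of degree `h` of the graded ring `(A, 𝒜)`:
`M₀ = ⨁ i, A(d i)`, `M₁ = ⨁ i, A(e i)`, `φ : M₁ → M₀`, `ψ : M₀(-h) → M₁`. A matrix `m` gives a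
degree-preserving map `⨁ j, A(b j) → ⨁ i, A(c i)` if and only if `m i j` has degree `c i - b j`
for all `i` and `j`. -/
structure MatFac (𝒜 : ℤ → AddSubgroup A) (f : A) (h : ℤ) where
  /-- The index set; its cardinality is the rank. -/
  ι : Type
  [fintype : Fintype ι]
  [decidableEq : DecidableEq ι]
  /-- The shifts of `M₀`. -/
  d : ι → ℤ
  /-- The shifts of `M₁`. -/
  e : ι → ℤ
  /-- The map `M₁ → M₀`. -/
  φ : Matrix ι ι A
  /-- The map `M₀(-h) → M₁`. -/
  ψ : Matrix ι ι A
  φ_mem : ∀ i j, φ i j ∈ 𝒜 (d i - e j)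
  ψ_mem : ∀ i j, ψ i j ∈ 𝒜 (e i - (d j - h))
  φ_mul_ψ : φ * ψ = f • (1 : Matrix ι ι A)
  ψ_mul_φ : ψ * φ = f • (1 : Matrix ι ι A)

namespace MatFac

attribute [instance] fintype decidableEq

variable {𝒜 : ℤ → AddSubgroup A} {f : A} {h : ℤ}

/-- The rank of a graded matrix factorization. -/
def rank (E : MatFac 𝒜 f h) : ℕ := Fintype.card E.ι

/-- A morphism of graded matrix factorizations: `α : M₀ → M₀'` and `β : M₁ → M₁'`. -/
@[ext]
structure Hom (E E' : MatFac 𝒜 f h) where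
  /-- The map `M₀ → M₀'`. -/
  α : Matrix E'.ι E.ι A
  /-- The map `M₁ → M₁'`. -/
  β : Matrix E'.ι E.ι A
  α_mem : ∀ i j, α i j ∈ 𝒜 (E'.d i - E.d j)
  β_mem : ∀ i j, β i j ∈ 𝒜 (E'.e i - E.e j)
  comm_φ : α * E.φ = E'.φ * β
  comm_ψ : β * E.ψ = E'.ψ * α

lemma mul_mem [SetLike.GradedMonoid 𝒜] {ι κ μ : Type} [Fintype κ] {b : ι → ℤ} {c : κ → ℤ}
    {d : μ → ℤ} {m : Matrix μ κ A} {n : Matrix κ ι A} (hm : ∀ i j, m i j ∈ 𝒜 (d i - c j))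
    (hn : ∀ i j, n i j ∈ 𝒜 (c i - b j)) (i : μ) (j : ι) : (m * n) i j ∈ 𝒜 (d i - b j) := by
  rw [Matrix.mul_apply]
  refine sum_mem fun k _ => ?_
  have := SetLike.GradedMul.mul_mem (A := 𝒜) (hm i k) (hn k j)
  rwa [sub_add_sub_cancel] at this

lemma one_mem [SetLike.GradedMonoid 𝒜] {ι : Type} [DecidableEq ι] {d : ι → ℤ} (i j : ι) :
    (1 : Matrix ι ι A) i j ∈ 𝒜 (d i - d j) := by
  by_cases hij : i = j
  · subst hij
    rw [Matrix.one_apply_eq, sub_self]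
    exact SetLike.GradedOne.one_mem
  · rw [Matrix.one_apply_ne hij]
    exact zero_mem _

instance [SetLike.GradedMonoid 𝒜] : Category (MatFac 𝒜 f h) where
  Hom E E' := Hom E E'
  id E := ⟨1, 1, one_mem, one_mem, by simp, by simp⟩
  comp {E E' E''} a b :=
    { α := Hom.α b * Hom.α a
      β := Hom.β b * Hom.β a
      α_mem := mul_mem (Hom.α_mem b) (Hom.α_mem a)
      β_mem := mul_mem (Hom.β_mem b) (Hom.β_mem a)
      comm_φ := by
        rw [Matrix.mul_assoc, Hom.comm_φ a, ← Matrix.mul_assoc, Hom.comm_φ b, Matrix.mul_assoc]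
      comm_ψ := by
        rw [Matrix.mul_assoc, Hom.comm_ψ a, ← Matrix.mul_assoc, Hom.comm_ψ b, Matrix.mul_assoc] }
  id_comp a := Hom.ext (Matrix.mul_one _) (Matrix.mul_one _)
  comp_id a := Hom.ext (Matrix.one_mul _) (Matrix.one_mul _)
  assoc a b c := Hom.ext (Matrix.mul_assoc _ _ _).symm (Matrix.mul_assoc _ _ _).symm

/-- Two morphisms of graded matrix factorizations are homotopic if they differ by the boundary of a
pair `ξ : M₀ → M₁'`, `η : M₁ → M₀'(-h)`. -/
def homotopic (𝒜 : ℤ → AddSubgroup A) [SetLike.GradedMonoid 𝒜] (f : A) (h : ℤ) :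
    HomRel (MatFac 𝒜 f h) := fun E E' a b =>
  ∃ ξ η : Matrix E'.ι E.ι A,
    (∀ i j, ξ i j ∈ 𝒜 (E'.e i - E.d j)) ∧
    (∀ i j, η i j ∈ 𝒜 ((E'.d i - h) - E.e j)) ∧
    Hom.α a - Hom.α b = E'.φ * ξ + η * E.ψ ∧
    Hom.β a - Hom.β b = E'.ψ * η + ξ * E.φ

/-- Homotopy is an equivalence relation compatible with composition. -/
instance [SetLike.GradedMonoid 𝒜] : Congruence (homotopic 𝒜 f h) where
  equivalence {E E'} :=
    { refl := fun a => ⟨0, 0, fun _ _ => zero_mem _, fun _ _ => zero_mem _, by simp, by simp⟩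
      symm := by
        rintro a b ⟨ξ, η, hξ, hη, h1, h2⟩
        refine ⟨-ξ, -η, fun i j => neg_mem (hξ i j), fun i j => neg_mem (hη i j), ?_, ?_⟩
        · rw [← neg_sub, h1, Matrix.mul_neg, Matrix.neg_mul, neg_add]
        · rw [← neg_sub, h2, Matrix.mul_neg, Matrix.neg_mul, neg_add]
      trans := by
        rintro a b c ⟨ξ, η, hξ, hη, h1, h2⟩ ⟨ξ', η', hξ', hη', h1', h2'⟩
        refine ⟨ξ + ξ', η + η', fun i j => add_mem (hξ i j) (hξ' i j),
          fun i j => add_mem (hη i j) (hη' i j), ?_, ?_⟩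
        · rw [← sub_add_sub_cancel, h1, h1', Matrix.mul_add, Matrix.add_mul]
          abel
        · rw [← sub_add_sub_cancel, h2, h2', Matrix.mul_add, Matrix.add_mul]
          abel }
  comp_left {E E' E''} c a b := by
    rintro ⟨ξ, η, hξ, hη, h1, h2⟩
    refine ⟨ξ * Hom.α c, η * Hom.β c, mul_mem hξ (Hom.α_mem c),
      mul_mem (d := fun i => E''.d i - h) hη (Hom.β_mem c), ?_, ?_⟩
    · change Hom.α a * Hom.α c - Hom.α b * Hom.α c = _
      rw [← Matrix.sub_mul, h1, Matrix.add_mul, Matrix.mul_assoc, Matrix.mul_assoc,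
        ← Hom.comm_ψ c, Matrix.mul_assoc]
    · change Hom.β a * Hom.β c - Hom.β b * Hom.β c = _
      rw [← Matrix.sub_mul, h2, Matrix.add_mul, Matrix.mul_assoc, Matrix.mul_assoc,
        ← Hom.comm_φ c, Matrix.mul_assoc]
  comp_right {E E' E'' a b} c := by
    rintro ⟨ξ, η, hξ, hη, h1, h2⟩
    refine ⟨Hom.β c * ξ, Hom.α c * η, mul_mem (Hom.β_mem c) hξ,
      mul_mem (c := fun i => E'.d i - h) (d := fun i => E''.d i - h)
        (fun i j => by simpa using Hom.α_mem c i j) hη, ?_, ?_⟩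
    · change Hom.α c * Hom.α a - Hom.α c * Hom.α b = _
      rw [← Matrix.mul_sub, h1, Matrix.mul_add, ← Matrix.mul_assoc, ← Matrix.mul_assoc,
        Hom.comm_φ c, Matrix.mul_assoc]
    · change Hom.β c * Hom.β a - Hom.β c * Hom.β b = _
      rw [← Matrix.mul_sub, h2, Matrix.mul_add, ← Matrix.mul_assoc, ← Matrix.mul_assoc,
        Hom.comm_ψ c, Matrix.mul_assoc]

end MatFac

/-- The homotopy category of graded matrix factorizations of `f`: the same objects, and homotopy
classes of morphisms. -/
abbrev Hmf (𝒜 : ℤ → AddSubgroup A) [SetLike.GradedMonoid 𝒜] (f : A) (h : ℤ) : Type _ :=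
  CategoryTheory.Quotient (MatFac.homotopic 𝒜 f h)

/-- The functor from graded matrix factorizations to their homotopy category, the identity on
objects. -/
abbrev toHmf (𝒜 : ℤ → AddSubgroup A) [SetLike.GradedMonoid 𝒜] (f : A) (h : ℤ) :
    MatFac 𝒜 f h ⥤ Hmf 𝒜 f h :=
  CategoryTheory.Quotient.functor (MatFac.homotopic 𝒜 f h)

end MatFac

section Stabilization

variable {A : Type u} [CommRing A] (𝒜 : ℤ → AddSubgroup A) [GradedRing 𝒜] {f : A} {h : ℤ}
  (hf : f ∈ 𝒜 h)

/-- The graded free module `⨁ i, Ā(d i)` over `Ā = A / (f)`. -/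
noncomputable abbrev freeBar {ι : Type} [Fintype ι] [DecidableEq ι] (d : ι → ℤ) :
    GrModFG (quotGrading 𝒜 f) :=
  GrModFG.free (isInternal_quotGrading 𝒜 (DirectSum.Decomposition.isInternal 𝒜) hf) d

variable {ι κ μ : Type} [Fintype ι] [DecidableEq ι] [Fintype κ] [DecidableEq κ]
  [Fintype μ] [DecidableEq μ]

/-- The morphism over `Ā = A / (f)` induced by a matrix over `A`. -/
noncomputable abbrev barMap {b : ι → ℤ} {c : κ → ℤ} (m : Matrix κ ι A)
    (hm : ∀ i j, m i j ∈ 𝒜 (c i - b j)) : freeBar 𝒜 hf b ⟶ freeBar 𝒜 hf c :=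
  GrModFG.freeMap (isInternal_quotGrading 𝒜 (DirectSum.Decomposition.isInternal 𝒜) hf)
    (m.map (Ideal.Quotient.mk (Ideal.span {f}))) fun i j => ⟨m i j, hm i j, rfl⟩

variable {𝒜}

lemma barMap_congr {b : ι → ℤ} {c : κ → ℤ} {m n : Matrix κ ι A} (hmn : m = n) (hm)  :
    barMap 𝒜 hf (b := b) (c := c) m hm = barMap 𝒜 hf n (hmn ▸ hm) := by
  subst hmn
  rfl

lemma barMap_one {b : ι → ℤ} : barMap 𝒜 hf (b := b) 1 MatFac.one_mem = 𝟙 _ := by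
  refine GrModFG.hom_ext fun v => ?_
  change Matrix.mulVec _ _ = v
  rw [Matrix.map_one _ (map_zero _) (map_one _)]
  exact Matrix.one_mulVec _

lemma barMap_comp {b : ι → ℤ} {c : κ → ℤ} {d : μ → ℤ} (m : Matrix κ ι A) (n : Matrix μ κ A)
    (hm : ∀ i j, m i j ∈ 𝒜 (c i - b j)) (hn : ∀ i j, n i j ∈ 𝒜 (d i - c j)) :
    barMap 𝒜 hf m hm ≫ barMap 𝒜 hf n hn = barMap 𝒜 hf (n * m) (MatFac.mul_mem hn hm) := by
  refine GrModFG.hom_ext fun v => ?_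
  refine (Matrix.mulVec_mulVec (v : ι → A ⧸ Ideal.span {f}) _ _).trans ?_
  rw [← Matrix.map_mul]
  rfl

lemma barMap_add {b : ι → ℤ} {c : κ → ℤ} (m n : Matrix κ ι A)
    (hm : ∀ i j, m i j ∈ 𝒜 (c i - b j)) (hn : ∀ i j, n i j ∈ 𝒜 (c i - b j)) :
    barMap 𝒜 hf (m + n) (fun i j => add_mem (hm i j) (hn i j)) =
      barMap 𝒜 hf m hm + barMap 𝒜 hf n hn := by
  refine GrModFG.hom_ext fun v => ?_
  refine Eq.trans ?_ (Matrix.add_mulVec _ _ (v : ι → A ⧸ Ideal.span {f}))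
  rw [← Matrix.map_add _ (map_add _)]
  rfl

lemma barMap_eq_zero {b c : ι → ℤ} (hm : ∀ i j, (f • (1 : Matrix ι ι A)) i j ∈ 𝒜 (c i - b j)) :
    barMap 𝒜 hf (f • (1 : Matrix ι ι A)) hm = 0 := by
  refine GrModFG.hom_ext fun v => ?_
  change Matrix.mulVec _ _ = 0
  have : (f • (1 : Matrix ι ι A)).map (Ideal.Quotient.mk (Ideal.span {f})) = 0 := by
    ext i j
    simp only [Matrix.map_apply, Matrix.smul_apply, smul_eq_mul, map_mul, Matrix.zero_apply]
    rw [Ideal.Quotient.eq_zero_iff_mem.2 (Ideal.mem_span_singleton_self f), zero_mul]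
  rw [this]
  exact Matrix.zero_mulVec _

variable (𝒜) in
/-- The functor `(φ, ψ) ↦ coker φ̄` from graded matrix factorizations of `f` to finitely generated
graded modules over `A / (f)`, where `φ̄ : ⨁ i, Ā(e i) ⟶ ⨁ i, Ā(d i)` is induced by `φ`. -/
noncomputable def cokerFunctor : MatFac 𝒜 f h ⥤ GrModFG (quotGrading 𝒜 f) where
  obj E := cokernel (barMap 𝒜 hf E.φ E.φ_mem)
  map {E E'} a := cokernel.map _ _
    (barMap 𝒜 hf (MatFac.Hom.β a) (MatFac.Hom.β_mem a))
    (barMap 𝒜 hf (MatFac.Hom.α a) (MatFac.Hom.α_mem a)) (by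
      rw [barMap_comp, barMap_comp]
      exact barMap_congr hf (MatFac.Hom.comm_φ a) _)
  map_id E := by
    rw [← cancel_epi (cokernel.π _)]
    simp only [cokernel.π_desc, Category.comp_id]
    exact (congrArg (· ≫ cokernel.π _) (barMap_one hf)).trans (Category.id_comp _)
  map_comp {E E' E''} a b := by
    rw [← cancel_epi (cokernel.π _)]
    simp only [cokernel.π_desc, cokernel.π_desc_assoc, Category.assoc]
    rw [← Category.assoc, barMap_comp]
    rfl

lemma exists_factor {E E' : MatFac 𝒜 f h} {a b : E ⟶ E'} (hab : MatFac.homotopic 𝒜 f h a b) :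
    ∃ (u : (cokerFunctor 𝒜 hf).obj E ⟶ freeBar 𝒜 hf (fun i => E.e i + h))
      (v : freeBar 𝒜 hf (fun i => E.e i + h) ⟶ (cokerFunctor 𝒜 hf).obj E'),
      (cokerFunctor 𝒜 hf).map a = (cokerFunctor 𝒜 hf).map b + u ≫ v := by
  obtain ⟨ξ, η, hξ, hη, h1, -⟩ := hab
  have hψ : ∀ i j, E.ψ i j ∈ 𝒜 ((E.e i + h) - E.d j) := fun i j => by
    have := E.ψ_mem i j
    rwa [show E.e i - (E.d j - h) = E.e i + h - E.d j by ring] at this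
  have hη' : ∀ i j, η i j ∈ 𝒜 (E'.d i - (E.e j + h)) := fun i j => by
    have := hη i j
    rwa [show E'.d i - h - E.e j = E'.d i - (E.e j + h) by ring] at this
  have hw : barMap 𝒜 hf E.φ E.φ_mem ≫ barMap 𝒜 hf (c := fun i => E.e i + h) E.ψ hψ = 0 := by
    rw [barMap_comp]
    exact (barMap_congr hf E.ψ_mul_φ _).trans (barMap_eq_zero hf _)
  refine ⟨cokernel.desc _ (barMap 𝒜 hf (c := fun i => E.e i + h) E.ψ hψ) hw,
    barMap 𝒜 hf (b := fun i => E.e i + h) η hη' ≫ cokernel.π _, ?_⟩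
  · refine (cancel_epi (cokernel.π (barMap 𝒜 hf E.φ E.φ_mem))).1 ?_
    refine Eq.trans ?_ (Preadditive.comp_add _ _ _ _ _ _).symm
    have hα : MatFac.Hom.α a = MatFac.Hom.α b + (E'.φ * ξ + η * E.ψ) := by
      rw [← h1]
      abel
    have e1 : cokernel.π (barMap 𝒜 hf E.φ E.φ_mem) ≫ (cokerFunctor 𝒜 hf).map a =
        barMap 𝒜 hf (MatFac.Hom.α a) (MatFac.Hom.α_mem a) ≫ cokernel.π _ := cokernel.π_desc _ _ _
    have e2 : cokernel.π (barMap 𝒜 hf E.φ E.φ_mem) ≫ (cokerFunctor 𝒜 hf).map b =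
        barMap 𝒜 hf (MatFac.Hom.α b) (MatFac.Hom.α_mem b) ≫ cokernel.π _ := cokernel.π_desc _ _ _
    have m1 := MatFac.mul_mem E'.φ_mem hξ
    have m2 := MatFac.mul_mem (d := E'.d) (c := fun i => E.e i + h) (b := E.d) hη' hψ
    have e3 : cokernel.π (barMap 𝒜 hf E.φ E.φ_mem) ≫
        cokernel.desc _ (barMap 𝒜 hf (c := fun i => E.e i + h) E.ψ hψ) hw ≫
          barMap 𝒜 hf (b := fun i => E.e i + h) η hη' ≫ cokernel.π (barMap 𝒜 hf E'.φ E'.φ_mem) =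
        barMap 𝒜 hf (c := fun i => E.e i + h) E.ψ hψ ≫
          barMap 𝒜 hf (b := fun i => E.e i + h) η hη' ≫ cokernel.π _ := cokernel.π_desc_assoc _ _ _ _
    refine e1.trans (Eq.trans ?_
      (congrArg₂ (fun (x y : freeBar 𝒜 hf E.d ⟶ (cokerFunctor 𝒜 hf).obj E') => x + y) e2 e3).symm)
    rw [barMap_congr hf hα, barMap_add hf (MatFac.Hom.α b) (E'.φ * ξ + η * E.ψ)
      (MatFac.Hom.α_mem b) (fun i j => add_mem (m1 i j) (m2 i j)), barMap_add hf _ _ m1 m2,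
      ← barMap_comp hf ξ E'.φ hξ E'.φ_mem,
      ← barMap_comp hf (c := fun i => E.e i + h) E.ψ η hψ hη',
      Preadditive.add_comp, Preadditive.add_comp, Category.assoc, cokernel.condition, comp_zero,
      zero_add, Category.assoc]
    rfl

variable (𝒜) in
/-- The functor `Hmf_A^gr(f) ⥤ D^b_sing(gr A/(f))` induced by `(φ, ψ) ↦ coker φ̄`. -/
noncomputable def stab [IsNoetherianRing A] :
    Hmf 𝒜 f h ⥤ Dsing (GrModFG (quotGrading 𝒜 f)) :=
  CategoryTheory.Quotient.lift _ (cokerFunctor 𝒜 hf ⋙ singleDb _ ⋙ toDsing _) (by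
    intro E E' a b hab
    obtain ⟨u, v, huv⟩ := exists_factor hf hab
    have hz : IsZero ((toDsing _).obj
        ((singleDb _).obj (freeBar 𝒜 hf (fun i => E.e i + h)))) :=
      isZero_toDsing _ _ (perfD_single _ _ 0)
    simp only [Functor.comp_map]
    rw [huv, Functor.map_add, Functor.map_add, Functor.map_comp, Functor.map_comp,
      hz.eq_of_src ((toDsing _).map ((singleDb _).map v)) 0, comp_zero, add_zero])

end Stabilization

section PushForward

variable {R : Type u} [CommRing R] (𝒜 : ℤ → AddSubgroup R)
  {f : R} {h : ℤ} (a : ℤ) (g : Polynomial R)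

/-- The ring homomorphism `R[w] / (f + w g) → R / (f)` sending `w` to `0`. -/
noncomputable def pr (f : R) (g : Polynomial R) :
    (Polynomial R ⧸ Ideal.span {Polynomial.C f + Polynomial.X * g}) →+* R ⧸ Ideal.span {f} :=
  Ideal.Quotient.lift _ ((Ideal.Quotient.mk (Ideal.span {f})).comp Polynomial.constantCoeff) (by
    intro p hp
    obtain ⟨q, rfl⟩ := Ideal.mem_span_singleton.1 hp
    refine Ideal.Quotient.eq_zero_iff_mem.2 (Ideal.mem_span_singleton.2 ?_)
    simp)

lemma pr_mk (p : Polynomial R) :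
    pr f g (Ideal.Quotient.mk _ p) = Ideal.Quotient.mk _ (p.coeff 0) := rfl

lemma pr_surjective : Function.Surjective (pr f g) := by
  intro x
  obtain ⟨x, rfl⟩ := Ideal.Quotient.mk_surjective x
  exact ⟨Ideal.Quotient.mk _ (Polynomial.C x), by rw [pr_mk, Polynomial.coeff_C_zero]⟩

lemma pr_mem (n : ℤ) (x) (hx : x ∈ quotGrading (polyGrading 𝒜 a)
    (Polynomial.C f + Polynomial.X * g) n) : pr f g x ∈ quotGrading 𝒜 f n := by
  obtain ⟨p, hp, rfl⟩ := hx
  refine ⟨p.coeff 0, ?_, rfl⟩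
  simpa using hp 0

/-- The functor sending a finitely generated graded `R/(f)`-module to the same module considered as
a graded module over `R[w]/(f + w g)`. -/
noncomputable def pushMod : GrModFG (quotGrading 𝒜 f) ⥤
    GrModFG (quotGrading (polyGrading 𝒜 a) (Polynomial.C f + Polynomial.X * g)) :=
  GrModFG.res (pr f g) (pr_mem 𝒜 a g) (pr_surjective g)

variable {𝒜} {a g}

lemma X_mul_eq_zero (hf0 : f ∈ nonZeroDivisors R)
    (x : Polynomial R ⧸ Ideal.span {Polynomial.C f + Polynomial.X * g})
    (hx : Ideal.Quotient.mk _ Polynomial.X * x = 0) : x = 0 := by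
  obtain ⟨p, rfl⟩ := Ideal.Quotient.mk_surjective x
  rw [← map_mul, Ideal.Quotient.eq_zero_iff_mem, Ideal.mem_span_singleton] at hx
  obtain ⟨q, hq⟩ := hx
  have h0 : f * q.coeff 0 = 0 := by
    have := congrArg (fun r => Polynomial.coeff r 0) hq
    simpa using this.symm
  have h1 : q.coeff 0 = 0 := (mem_nonZeroDivisors_iff.1 hf0).1 _ h0
  obtain ⟨q', rfl⟩ := Polynomial.X_dvd_iff.2 h1
  refine Ideal.Quotient.eq_zero_iff_mem.2 (Ideal.mem_span_singleton.2 ⟨q', ?_⟩)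
  refine (Polynomial.isRegular_X (R := R)).left ?_
  refine hq.trans ?_
  ring

lemma exists_of_pr_eq_zero (x : Polynomial R ⧸ Ideal.span {Polynomial.C f + Polynomial.X * g})
    (hx : pr f g x = 0) : ∃ y, Ideal.Quotient.mk _ Polynomial.X * y = x := by
  obtain ⟨p, rfl⟩ := Ideal.Quotient.mk_surjective x
  rw [pr_mk, Ideal.Quotient.eq_zero_iff_mem, Ideal.mem_span_singleton] at hx
  obtain ⟨c, hc⟩ := hx
  obtain ⟨q, hq⟩ : Polynomial.X ∣ p - (Polynomial.C f + Polynomial.X * g) * Polynomial.C c := by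
    rw [Polynomial.X_dvd_iff]
    simp [hc]
  refine ⟨Ideal.Quotient.mk _ q, ?_⟩
  rw [← map_mul, Ideal.Quotient.eq, Ideal.mem_span_singleton, ← hq]
  exact ⟨-Polynomial.C c, by ring⟩

lemma g_mem (hF : Polynomial.C f + Polynomial.X * g ∈ polyGrading 𝒜 a h) :
    g ∈ polyGrading 𝒜 a (h - a) := by
  intro k
  have := hF (k + 1)
  rw [Polynomial.coeff_add, Polynomial.coeff_C_succ, zero_add, Polynomial.coeff_X_mul] at this
  rwa [show h - a - k * a = h - ((k + 1 : ℕ) : ℤ) * a by push_cast; ring]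

variable [GradedRing 𝒜]

lemma hasProjectiveDimensionLT_free [IsNoetherianRing R] (hf : f ∈ 𝒜 h)
    (hF : Polynomial.C f + Polynomial.X * g ∈ polyGrading 𝒜 a h) (hf0 : f ∈ nonZeroDivisors R)
    {ι : Type} [Fintype ι] [DecidableEq ι] (d : ι → ℤ) :
    HasProjectiveDimensionLT ((pushMod 𝒜 a g).obj (freeBar 𝒜 hf d)) 2 := by
  let S1 := freeBar (polyGrading 𝒜 a) hF (fun i => d i - a)
  let S2 := freeBar (polyGrading 𝒜 a) hF d
  let α : S1 ⟶ S2 := GrModFG.ofLin (M := S1) (N := S2)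
    { toFun := fun v i => Ideal.Quotient.mk _ Polynomial.X * v i
      map_add' := fun v w => funext fun i => mul_add _ (v i) (w i)
      map_smul' := fun c v => funext fun i => mul_left_comm _ c (v i) } (by
      intro n v hv i
      have hX : Ideal.Quotient.mk (Ideal.span {Polynomial.C f + Polynomial.X * g})
        Polynomial.X ∈ quotGrading (polyGrading 𝒜 a) (Polynomial.C f + Polynomial.X * g) a :=
          ⟨_, X_mem_polyGrading, rfl⟩
      have := SetLike.GradedMul.mul_mem hX (hv i)
      rwa [show a + (n + (d i - a)) = n + d i by ring] at this)
  let β : S2 ⟶ (pushMod 𝒜 a g).obj (freeBar 𝒜 hf d) :=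
    GrModFG.ofLin (M := S2) (N := (pushMod 𝒜 a g).obj (freeBar 𝒜 hf d))
      { toFun := fun v i => pr f g (v i)
        map_add' := fun v w => funext fun i => map_add (pr f g) (v i) (w i)
        map_smul' := fun c v => funext fun i => map_mul (pr f g) c (v i) }
      (fun n v hv i => pr_mem 𝒜 a g _ _ (hv i))
  have hα : Function.Injective (GrModFG.lin α) := by
    rw [injective_iff_map_eq_zero]
    intro v hv
    exact funext fun i => X_mul_eq_zero hf0 _ (congrFun hv i)
  have hβ : Function.Surjective (GrModFG.lin β) := fun v =>
    ⟨fun i => (pr_surjective g (v i)).choose, funext fun i => (pr_surjective g (v i)).choose_spec⟩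
  have hw : α ≫ β = 0 := by
    refine GrModFG.hom_ext fun v => funext fun i => ?_
    change pr f g (Ideal.Quotient.mk _ Polynomial.X * v i) = 0
    rw [map_mul, pr_mk, Polynomial.coeff_X_zero, map_zero, zero_mul]
  have hex : ∀ v, GrModFG.lin β v = 0 → ∃ u, GrModFG.lin α u = v := by
    intro v hv
    have := fun i => exists_of_pr_eq_zero (v i) (congrFun hv i)
    choose u hu using this
    exact ⟨u, funext hu⟩
  have hS : (ShortComplex.mk α β hw).ShortExact :=
    { exact := ShortComplex.exact_of_f_is_kernel _ (GrModFG.isLimitOfExact α β hw hα hex)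
      mono_f := GrModFG.mono_of_injective α hα
      epi_g := GrModFG.epi_of_surjective β hβ }
  exact hS.hasProjectiveDimensionLT_X₃ 1 inferInstance inferInstance

lemma hasProjectiveDimensionLT_pushMod [IsNoetherianRing R] (hf : f ∈ 𝒜 h)
    (hF : Polynomial.C f + Polynomial.X * g ∈ polyGrading 𝒜 a h) (hf0 : f ∈ nonZeroDivisors R)
    (X : GrModFG (quotGrading 𝒜 f)) (hX : Projective X) :
    HasProjectiveDimensionLT ((pushMod 𝒜 a g).obj X) 2 := by
  obtain ⟨n, d, p, hp⟩ := GrModFG.exists_free_epi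
    (isInternal_quotGrading 𝒜 (DirectSum.Decomposition.isInternal 𝒜) hf) X
  let r : Retract X (freeBar 𝒜 hf d) :=
    { i := Projective.factorThru (𝟙 X) p
      r := p
      retract := Projective.factorThru_comp _ _ }
  have := hasProjectiveDimensionLT_free hf hF hf0 d
  exact (r.map (pushMod 𝒜 a g)).hasProjectiveDimensionLT 2

noncomputable instance [IsNoetherianRing R] : PreservesFiniteLimits (pushMod 𝒜 (f := f) a g) := by
  unfold pushMod
  infer_instance

noncomputable instance [IsNoetherianRing R] :
    PreservesFiniteColimits (pushMod 𝒜 (f := f) a g) := by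
  unfold pushMod
  infer_instance

instance : (pushMod 𝒜 (f := f) a g).Additive := by
  unfold pushMod
  infer_instance

variable (𝒜 a g) in
/-- The push-forward functor `D^b_sing(gr R/(f)) ⥤ D^b_sing(gr R[w]/(f + w g))` induced by the
exact functor `pushMod`; it exists because `pushMod` preserves perfect complexes. -/
noncomputable def pushSing [IsNoetherianRing R] (hf : f ∈ 𝒜 h)
    (hF : Polynomial.C f + Polynomial.X * g ∈ polyGrading 𝒜 a h) (hf0 : f ∈ nonZeroDivisors R) :
    Dsing (GrModFG (quotGrading 𝒜 f)) ⥤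
      Dsing (GrModFG (quotGrading (polyGrading 𝒜 a) (Polynomial.C f + Polynomial.X * g))) :=
  have : EnoughProjectives
      (GrModFG (quotGrading (polyGrading 𝒜 a) (Polynomial.C f + Polynomial.X * g))) :=
    GrModFG.enoughProjectives (isInternal_quotGrading (polyGrading 𝒜 a)
      (DirectSum.Decomposition.isInternal _) hF)
  Localization.lift (mapDb (pushMod 𝒜 a g) ⋙ toDsing _)
    (mapDb_inverts (pushMod 𝒜 a g) (hasProjectiveDimensionLT_pushMod hf hF hf0)) (toDsing _)

lemma smul_one_mem {A : Type*} [CommRing A] {𝒜 : ℤ → AddSubgroup A} {ι : Type} [DecidableEq ι]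
    {b c : ι → ℤ} {x : A} {n : ℤ} (hx : x ∈ 𝒜 n) (hbc : ∀ i, c i - b i = n) (i j : ι) :
    (x • (1 : Matrix ι ι A)) i j ∈ 𝒜 (c i - b j) := by
  by_cases hij : i = j
  · subst hij
    simpa [hbc] using hx
  · simp [Matrix.one_apply_ne hij]

/-- For a graded matrix factorization `(φ, ψ)` of `f` over `R`, the graded matrix factorization
`φ' = [[φ, w], [-g, ψ]]`, `ψ' = [[ψ, -w], [g, φ]]` of `F = f + w g` over `R[w]`, with
`M₀' = ⨁ S(d i) ⊕ ⨁ S(e i + h - a)` and `M₁' = ⨁ S(e i) ⊕ ⨁ S(d i - a)`, where `S = R[w]`. -/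
noncomputable def MatFac.push (hF : Polynomial.C f + Polynomial.X * g ∈ polyGrading 𝒜 a h)
    (E : MatFac 𝒜 f h) :
    MatFac (polyGrading 𝒜 a) (Polynomial.C f + Polynomial.X * g) h where
  ι := E.ι ⊕ E.ι
  d := Sum.elim E.d (fun i => E.e i + h - a)
  e := Sum.elim E.e (fun i => E.d i - a)
  φ := Matrix.fromBlocks (E.φ.map Polynomial.C)
    ((Polynomial.X : Polynomial R) • (1 : Matrix E.ι E.ι (Polynomial R)))
    (-(g • (1 : Matrix E.ι E.ι (Polynomial R)))) (E.ψ.map Polynomial.C)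
  ψ := Matrix.fromBlocks (E.ψ.map Polynomial.C)
    (-((Polynomial.X : Polynomial R) • (1 : Matrix E.ι E.ι (Polynomial R))))
    (g • (1 : Matrix E.ι E.ι (Polynomial R))) (E.φ.map Polynomial.C)
  φ_mem := by
    rintro (i | i) (j | j)
    · exact C_mem_polyGrading (E.φ_mem i j)
    · exact smul_one_mem (c := E.d) (b := fun j => E.d j - a) X_mem_polyGrading
        (fun i => by ring) i j
    · exact neg_mem (smul_one_mem (c := fun i => E.e i + h - a) (b := E.e) (g_mem hF)
        (fun i => by ring) i j)
    · refine C_mem_polyGrading ?_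
      have := E.ψ_mem i j
      rwa [show E.e i - (E.d j - h) = E.e i + h - a - (E.d j - a) by ring] at this
  ψ_mem := by
    rintro (i | i) (j | j)
    · exact C_mem_polyGrading (E.ψ_mem i j)
    · exact neg_mem (smul_one_mem (c := E.e) (b := fun j => E.e j + h - a - h) X_mem_polyGrading
        (fun i => by ring) i j)
    · exact smul_one_mem (c := fun i => E.d i - a) (b := fun j => E.d j - h) (g_mem hF)
        (fun i => by ring) i j
    · refine C_mem_polyGrading ?_
      have := E.φ_mem i j
      rwa [show E.d i - E.e j = E.d i - a - (E.e j + h - a - h) by ring] at this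
  φ_mul_ψ := by
    have h1 : E.φ.map Polynomial.C * E.ψ.map Polynomial.C =
        Polynomial.C f • (1 : Matrix E.ι E.ι (Polynomial R)) := by
      rw [← Matrix.map_mul, E.φ_mul_ψ, Matrix.map_smul' _ _ _ (map_mul _),
        Matrix.map_one _ (map_zero _) (map_one _)]
    have h2 : E.ψ.map Polynomial.C * E.φ.map Polynomial.C =
        Polynomial.C f • (1 : Matrix E.ι E.ι (Polynomial R)) := by
      rw [← Matrix.map_mul, E.ψ_mul_φ, Matrix.map_smul' _ _ _ (map_mul _),
        Matrix.map_one _ (map_zero _) (map_one _)]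
    rw [Matrix.fromBlocks_multiply, ← Matrix.fromBlocks_one, Matrix.fromBlocks_smul]
    congr 1
    · simp [h1, add_smul, smul_smul, mul_comm g]
    · simp
    · simp
    · simp [h2, add_smul, smul_smul, add_comm]
  ψ_mul_φ := by
    have h1 : E.φ.map Polynomial.C * E.ψ.map Polynomial.C =
        Polynomial.C f • (1 : Matrix E.ι E.ι (Polynomial R)) := by
      rw [← Matrix.map_mul, E.φ_mul_ψ, Matrix.map_smul' _ _ _ (map_mul _),
        Matrix.map_one _ (map_zero _) (map_one _)]
    have h2 : E.ψ.map Polynomial.C * E.φ.map Polynomial.C =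
        Polynomial.C f • (1 : Matrix E.ι E.ι (Polynomial R)) := by
      rw [← Matrix.map_mul, E.ψ_mul_φ, Matrix.map_smul' _ _ _ (map_mul _),
        Matrix.map_one _ (map_zero _) (map_one _)]
    rw [Matrix.fromBlocks_multiply, ← Matrix.fromBlocks_one, Matrix.fromBlocks_smul]
    congr 1
    · simp [h2, add_smul, smul_smul, mul_comm g]
    · simp
    · simp
    · simp [h1, add_smul, smul_smul, add_comm]

lemma MatFac.rank_push (hF : Polynomial.C f + Polynomial.X * g ∈ polyGrading 𝒜 a h)
    (E : MatFac 𝒜 f h) : (E.push hF).rank = 2 * E.rank := by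
  change Fintype.card (E.ι ⊕ E.ι) = 2 * Fintype.card E.ι
  rw [Fintype.card_sum, two_mul]

end PushForward

end GrMF

open GrMF

/-!
Write `S = R[w]`, `F = f + w g`, and let bars denote reduction modulo `f` over `R` and modulo `F`
over `S`.

*Construction of the functor.* A morphism `(α, β)` is sent to `(diag(α, β), diag(β, α))`, and a
homotopy `(ξ, η)` to `(diag(ξ, η), diag(η, ξ))`, so `E ↦ Ẽ` is a functor `pushHmf` on homotopy
categories. The first row of `φ̃` is `(φ, w)`, so projecting `M̃₀` to its first summand and
reducing modulo `w` gives a natural epimorphism from the cokernel of `φ̃` to that of `φ̄`,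
regarded as a module over `S/(F)`. Over `S`, if `φ x + w z` is divisible by `F`, then `(x, z)` is
a value of `ψ̃`, because `φ` is injective and `w` is a non-zero-divisor; hence the kernel of this
epimorphism is the second summand of `M̃₀` modulo `F`, which is free (`shortExact_cokerPush`). In
the singularity category the epimorphism becomes an isomorphism, and this is the comparison of
functors `pushHmfCompStab`.

*Uniqueness.* It suffices that `C_S` be fully faithful (`stab_full`, `stab_faithful`), which holds
for every homogeneous non-zero-divisor of a Noetherian graded ring, regular or not, and so for
`F`. Since a matrix killed by `ψ` modulo `f` is a multiple of `φ`, and the first syzygy of `coker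
φ̄` is `coker ψ̄`, dimension shifting shows that `M = coker φ̄` satisfies `Extⁿ(M, Q) = 0` for `n
> 0` and `Q` projective (`higherExtVanishes_coker`). For such `M` the morphisms from `M` to `N` in
the singularity category are the morphisms of modules modulo those that factor through a
projective module: a fraction `M → Y ← N` can be replaced by one whose denominator is the class `N
→ N'[k + 1]` of a truncated projective resolution, because the cone of `N → Y` is perfect and `k`
may be taken large (`exists_syzygy_factor`), and every morphism `M → N'[k + 1]` lifts to `N` by
the vanishing of `Ext`. Finally, morphisms of cokernels lift to morphisms of matrix
factorizations, and those that factor through a projective module lift to null-homotopic ones.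
-/

namespace GrMF

/-! ### Morphisms in the bounded derived category -/

section SingularityCategory

variable {C : Type u} [Category.{v} C] [Abelian C] [HasDerivedCategory.{w} C]

/-- There are no nonzero morphisms in the derived category from a bounded complex of projectives to
an object placed in a degree to the left of it. -/
lemma eq_zero_of_strictlyGE (K : CochainComplex C ℤ) (a b n : ℤ) [K.IsStrictlyGE a]
    [K.IsStrictlyLE b] (hK : ∀ i, Projective (K.X i)) (hn : -n < a) (X : C)
    (x : DerivedCategory.Q.obj K ⟶ ((DerivedCategory.singleFunctor C 0).obj X)⟦n⟧) : x = 0 := by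
  have := CochainComplex.isKProjective_of_projective K b
  let L := (CochainComplex.singleFunctor C (-n)).obj X
  let e : ((DerivedCategory.singleFunctor C 0).obj X)⟦n⟧ ≅ DerivedCategory.Q.obj L :=
    ((DerivedCategory.singleFunctors C).shiftIso n (-n) 0 (by lia)).app X ≪≫
      (DerivedCategory.singleFunctorIsoCompQ C (-n)).app X
  obtain ⟨φ', hφ'⟩ := (CochainComplex.IsKProjective.Qh_map_bijective K
    ((HomotopyCategory.quotient _ _).obj L)).2
      ((DerivedCategory.quotientCompQhIso C).hom.app K ≫ x ≫ e.hom ≫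
        (DerivedCategory.quotientCompQhIso C).inv.app L)
  obtain ⟨φ, rfl⟩ := (HomotopyCategory.quotient C (ComplexShape.up ℤ)).map_surjective φ'
  have hφ : φ = 0 := by
    ext i
    by_cases hi : i < a
    · exact (K.isZero_of_isStrictlyGE a i hi).eq_of_src _ _
    · exact (HomologicalComplex.isZero_single_obj_X (ComplexShape.up ℤ) (-n) X i
        (by lia)).eq_of_tgt _ _
  rw [hφ, Functor.map_zero, Functor.map_zero] at hφ'
  rw [← cancel_mono (e.hom ≫ (DerivedCategory.quotientCompQhIso C).inv.app L),
    ← cancel_epi ((DerivedCategory.quotientCompQhIso C).hom.app K), ← hφ']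
  simp

lemma eq_zero_of_iso_Q (P : Db C) (K : CochainComplex C ℤ) (a b n : ℤ) [K.IsStrictlyGE a]
    [K.IsStrictlyLE b] (hK : ∀ i, Projective (K.X i)) (hn : -n < a)
    (e : P.obj ≅ DerivedCategory.Q.obj K) (X : C)
    (x : P ⟶ ((singleDb C).obj X)⟦n⟧) : x = 0 := by
  let ι := ObjectProperty.ι (DerivedCategory.TStructure.t (C := C)).bounded
  apply ι.map_injective
  have h0 := eq_zero_of_strictlyGE K a b n hK hn X
    (e.inv ≫ ι.map x ≫ (ι.commShiftIso n).hom.app _)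
  have h1 : ι.map x ≫ (ι.commShiftIso n).hom.app _ = 0 := by
    have := (Iso.inv_comp_eq e).1 h0
    exact this.trans comp_zero
  rw [← cancel_mono ((ι.commShiftIso n).hom.app ((singleDb C).obj X)), Functor.map_zero, zero_comp]
  exact h1

/-- A perfect complex has no nonzero morphisms to modules placed in sufficiently negative
degrees. -/
lemma exists_eq_zero_of_perf (P : Db C) (hP : perf C P) :
    ∃ k : ℕ, ∀ (X : C) (x : P ⟶ ((singleDb C).obj X)⟦((k : ℤ) + 1)⟧), x = 0 := by
  obtain ⟨K, a, b, ha, hb, hK, ⟨e⟩⟩ := hP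
  exact ⟨(-a).toNat, fun X x => eq_zero_of_iso_Q P K a b _ hK (by lia) e X x⟩

/-- Projective objects have no higher extensions. -/
lemma eq_zero_of_projective (Q : C) [Projective Q] (n : ℕ) (X : C)
    (x : (singleDb C).obj Q ⟶ ((singleDb C).obj X)⟦((n : ℤ) + 1)⟧) : x = 0 := by
  refine eq_zero_of_iso_Q _ ((CochainComplex.singleFunctor C 0).obj Q) 0 0 _ (fun m => ?_) (by lia)
    ((DerivedCategory.singleFunctorIsoCompQ C 0).app Q) X x
  by_cases h : m = 0
  · exact Projective.of_iso (HomologicalComplex.singleObjXIsoOfEq _ 0 Q m h).symm inferInstance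
  · exact (HomologicalComplex.isZero_single_obj_X (ComplexShape.up ℤ) 0 Q m h).projective

/-- A short exact sequence of objects is a distinguished triangle in the bounded derived
category. -/
lemma exists_distinguished_singleDb {S : ShortComplex C} (hS : S.ShortExact) :
    ∃ δ : (singleDb C).obj S.X₃ ⟶ ((singleDb C).obj S.X₁)⟦(1 : ℤ)⟧,
      Pretriangulated.Triangle.mk ((singleDb C).map S.f) ((singleDb C).map S.g) δ ∈
        Pretriangulated.distinguishedTriangles := by
  let ι := ObjectProperty.ι (DerivedCategory.TStructure.t (C := C)).bounded
  let d : ι.obj ((singleDb C).obj S.X₃) ⟶ (ι.obj ((singleDb C).obj S.X₁))⟦(1 : ℤ)⟧ := hS.singleδ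
  obtain ⟨δ, hδ⟩ := ι.map_surjective (d ≫ (ι.commShiftIso (1 : ℤ)).inv.app _)
  have h1 : ι.map δ ≫ (ι.commShiftIso (1 : ℤ)).hom.app _ = d := by
    rw [hδ, Category.assoc, Iso.inv_hom_id_app]
    exact Category.comp_id _
  refine ⟨δ, ?_⟩
  have : ι.mapTriangle.obj (Pretriangulated.Triangle.mk ((singleDb C).map S.f)
      ((singleDb C).map S.g) δ) = hS.singleTriangle :=
    congrArg (Pretriangulated.Triangle.mk (ι.map ((singleDb C).map S.f))
      (ι.map ((singleDb C).map S.g))) h1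
  change ι.mapTriangle.obj _ ∈ Pretriangulated.distinguishedTriangles
  rw [this]
  exact hS.singleTriangle_distinguished

instance : (singleDb C).Full where
  map_surjective f := by
    obtain ⟨g, hg⟩ := (DerivedCategory.singleFunctor C 0).map_surjective
      ((ObjectProperty.ι _).map f)
    exact ⟨g, (ObjectProperty.ι _).map_injective hg⟩

instance : (singleDb C).Faithful where
  map_injective h :=
    (DerivedCategory.singleFunctor C 0).map_injective (congrArg (ObjectProperty.ι _).map h)

end SingularityCategory

/-! ### Morphisms in the singularity category -/

section SingularityCategory

section Exactness

variable {T : Type*} [Category* T] [Preadditive T] [HasZeroObject T] [HasShift T ℤ]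
  [∀ n : ℤ, (shiftFunctor T n).Additive] [Pretriangulated T] {X Y Z W : T}
  {p : X ⟶ Y} {q : Y ⟶ Z} {r : Z ⟶ X⟦(1 : ℤ)⟧}

lemma exists_lift_shift₃
    (hT : Pretriangulated.Triangle.mk p q r ∈ Pretriangulated.distinguishedTriangles)
    (m : ℤ) (x : W ⟶ Z⟦m⟧) (hx : x ≫ r⟦m⟧' = 0) :
    ∃ y : W ⟶ Y⟦m⟧, x = y ≫ q⟦m⟧' := by
  have h0 : x ≫ (m.negOnePow • r⟦m⟧' ≫ (shiftFunctorComm T 1 m).hom.app X) = 0 := by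
    rw [Linear.comp_units_smul, reassoc_of% hx, zero_comp, smul_zero]
  obtain ⟨y, hy⟩ := Pretriangulated.Triangle.coyoneda_exact₃ _
    (Pretriangulated.Triangle.shift_distinguished _ hT m) x h0
  change W ⟶ Y⟦m⟧ at y
  replace hy : x = y ≫ (m.negOnePow • q⟦m⟧') := hy
  refine ⟨m.negOnePow • y, hy.trans ?_⟩
  rw [Linear.comp_units_smul, Linear.units_smul_comp]

lemma exists_lift_shift₁
    (hT : Pretriangulated.Triangle.mk p q r ∈ Pretriangulated.distinguishedTriangles)
    (m : ℤ) (x : W ⟶ X⟦(1 : ℤ)⟧⟦m⟧) (hx : x ≫ p⟦(1 : ℤ)⟧'⟦m⟧' = 0) :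
    ∃ y : W ⟶ Z⟦m⟧, x = y ≫ r⟦m⟧' := by
  refine exists_lift_shift₃ (Pretriangulated.rot_of_distTriang _ hT) m x ?_
  change x ≫ (-(p⟦(1 : ℤ)⟧'))⟦m⟧' = 0
  rw [Functor.map_neg, Preadditive.comp_neg, hx, neg_zero]

lemma exists_desc₃
    (hT : Pretriangulated.Triangle.mk p q r ∈ Pretriangulated.distinguishedTriangles)
    (x : Z ⟶ W) (hx : q ≫ x = 0) : ∃ y : X⟦(1 : ℤ)⟧ ⟶ W, x = r ≫ y :=
  Pretriangulated.Triangle.yoneda_exact₃ _ hT x hx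

end Exactness

variable {C : Type u} [Category.{v} C] [Abelian C] [HasDerivedCategory.{w} C]

/-- The condition `Extⁿ(M, Q) = 0` for all `n > 0` and all projective objects `Q`. -/
def HigherExtVanishes (M : C) : Prop :=
  ∀ (Q : C) [Projective Q] (n : ℕ)
    (x : (singleDb C).obj M ⟶ ((singleDb C).obj Q)⟦((n : ℤ) + 1)⟧), x = 0

/-- Let `δ : N ⟶ N'[k + 1]` be the class of a truncated projective resolution
`0 → N' → Q_k → ⋯ → Q_0 → N → 0`. Its cone is perfect; if the higher extensions of `M` by
projectives vanish, morphisms `M ⟶ N'[k + 1]` lift along `δ`, and morphisms `M ⟶ N` killed by `δ` factor through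
a projective object. -/
lemma exists_syzygy [EnoughProjectives C] (N : C) (k : ℕ) :
    ∀ n : ℤ, (k : ℤ) + 1 = n → ∃ (N' : C) (δ : (singleDb C).obj N ⟶ ((singleDb C).obj N')⟦n⟧),
      (perf C).trW δ ∧
      ∀ M : C, HigherExtVanishes M →
        (∀ x : (singleDb C).obj M ⟶ ((singleDb C).obj N')⟦n⟧, ∃ u, x = u ≫ δ) ∧
        ∀ u : (singleDb C).obj M ⟶ (singleDb C).obj N, u ≫ δ = 0 →
          ∃ (Q : C) (_ : Projective Q) (a : (singleDb C).obj M ⟶ (singleDb C).obj Q) (b : Q ⟶ N),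
            u = a ≫ (singleDb C).map b := by
  have hses : ∀ X : C, (ShortComplex.mk (kernel.ι (Projective.π X)) (Projective.π X)
      (kernel.condition _)).ShortExact := fun X => { exact := ShortComplex.exact_kernel _ }
  induction k with
  | zero =>
    rintro n hn
    obtain rfl : 1 = n := by simpa using hn
    obtain ⟨δ, hδ⟩ := exists_distinguished_singleDb (hses N)
    refine ⟨kernel (Projective.π N), δ, ?_, fun M hM => ⟨fun x => ?_, fun u hu => ?_⟩⟩
    · exact ((perf C).trW_iff_of_distinguished' _
        (Pretriangulated.rot_of_distTriang _ hδ)).2 (perfD_single C (Projective.over N) 0)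
    · exact Pretriangulated.Triangle.coyoneda_exact₁ _ hδ x (hM (Projective.over N) 0 _)
    · obtain ⟨a, ha⟩ := Pretriangulated.Triangle.coyoneda_exact₃ _ hδ u hu
      exact ⟨Projective.over N, inferInstance, a, Projective.π N, ha⟩
  | succ k ih =>
    rintro n hn
    obtain ⟨N', δ, h1, h2⟩ := ih _ rfl
    obtain ⟨δ', hδ'⟩ := exists_distinguished_singleDb (hses N')
    let e := (shiftFunctorAdd' (Db C) 1 ((k : ℤ) + 1) n (by push_cast at hn; lia)).app
      ((singleDb C).obj (kernel (Projective.π N')))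
    have hW : (perf C).trW (δ'⟦(k : ℤ) + 1⟧') :=
      ObjectProperty.trW.shift (((perf C).trW_iff_of_distinguished' _
        (Pretriangulated.rot_of_distTriang _ hδ')).2
          (perfD_single C (Projective.over N') 0)) _
    refine ⟨_, δ ≫ δ'⟦(k : ℤ) + 1⟧' ≫ e.inv, ?_, fun M hM => ⟨fun x => ?_, fun u hu => ?_⟩⟩
    · exact MorphismProperty.comp_mem _ _ _ h1 (MorphismProperty.comp_mem _ _ _ hW
        ((perf C).trW_of_isIso _))
    · have h3 : (x ≫ e.hom) ≫
          ((singleDb C).map (kernel.ι (Projective.π N')))⟦(1 : ℤ)⟧'⟦(k : ℤ) + 1⟧' = 0 := by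
        let e' := (shiftFunctorAdd' (Db C) 1 ((k : ℤ) + 1) n (by push_cast at hn; lia)).app
          ((singleDb C).obj (Projective.over N'))
        rw [← cancel_mono e'.inv, zero_comp]
        subst hn
        exact hM (Projective.over N') (k + 1) _
      obtain ⟨y, hy⟩ := exists_lift_shift₁ hδ' ((k : ℤ) + 1) (x ≫ e.hom) h3
      obtain ⟨u, hu⟩ := (h2 M hM).1 y
      refine ⟨u, ?_⟩
      rw [← cancel_mono e.hom]
      simp only [Category.assoc, Iso.inv_hom_id, Category.comp_id]
      rw [← Category.assoc, ← hu]
      exact hy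
    · have h3 : (u ≫ δ) ≫ δ'⟦(k : ℤ) + 1⟧' = 0 := by
        rw [← cancel_mono e.inv]
        simpa using hu
      obtain ⟨y, hy⟩ := exists_lift_shift₃ hδ' ((k : ℤ) + 1) (u ≫ δ) h3
      refine (h2 M hM).2 u (hy.trans ?_)
      rw [hM (Projective.over N') k y, zero_comp]

/-- Dimension shifting: if every object of a class is the quotient of a projective object by an
object of the class from which morphisms to projective objects extend, then the higher extensions
by projectives vanish. -/
lemma higherExtVanishes_of_class (P : C → Prop)
    (hP : ∀ M, P M → ∃ S : ShortComplex C, S.ShortExact ∧ P S.X₁ ∧ Projective S.X₂ ∧ S.X₃ = M ∧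
      ∀ (Q : C) [Projective Q] (x : S.X₁ ⟶ Q), ∃ y : S.X₂ ⟶ Q, x = S.f ≫ y)
    {M : C} (hM : P M) : HigherExtVanishes M := by
  intro Q hQ n
  suffices h : ∀ (n : ℕ) (m : ℤ), (n : ℤ) + 1 = m → ∀ (M : C), P M →
      ∀ x : (singleDb C).obj M ⟶ ((singleDb C).obj Q)⟦m⟧, x = 0 from h n _ rfl M hM
  clear hM M n
  intro n
  induction n with
  | zero =>
    intro m hm M hM x
    obtain rfl : 1 = m := by simpa using hm
    obtain ⟨S, hS, -, hproj, rfl, hext⟩ := hP M hM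
    obtain ⟨δ, hδ⟩ := exists_distinguished_singleDb hS
    obtain ⟨y, rfl⟩ := exists_desc₃ hδ x
      (eq_zero_of_projective S.X₂ 0 Q _)
    obtain ⟨z, rfl⟩ := (shiftFunctor (Db C) (1 : ℤ)).map_surjective y
    obtain ⟨z, rfl⟩ := (singleDb C).map_surjective z
    obtain ⟨w, rfl⟩ := hext Q z
    have h0 : δ ≫ ((singleDb C).map S.f)⟦(1 : ℤ)⟧' = 0 :=
      Pretriangulated.comp_distTriang_mor_zero₃₁ _ hδ
    rw [Functor.map_comp, Functor.map_comp, reassoc_of% h0, zero_comp]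
  | succ n ih =>
    intro m hm M hM x
    obtain ⟨S, hS, hS1, hproj, rfl, -⟩ := hP M hM
    obtain ⟨δ, hδ⟩ := exists_distinguished_singleDb hS
    obtain ⟨y, rfl⟩ := exists_desc₃ hδ x (by
      subst hm
      exact eq_zero_of_projective S.X₂ (n + 1) Q _)
    let e := (shiftFunctorAdd' (Db C) ((n : ℤ) + 1) 1 m (by push_cast at hm; lia)).app
      ((singleDb C).obj Q)
    obtain ⟨z, hz⟩ := (shiftFunctor (Db C) (1 : ℤ)).map_surjective (y ≫ e.hom)
    rw [ih _ rfl S.X₁ hS1 z, Functor.map_zero] at hz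
    rw [← cancel_mono e.hom, Category.assoc, ← hz, comp_zero, zero_comp]

variable [EnoughProjectives C]

/-- For every `s : N ⟶ Y` with perfect cone `P`, a sufficiently high syzygy class of `N` factors
through `s`, because the composite `P[-1] ⟶ N ⟶ N'[k + 1]` vanishes for large `k`. -/
lemma exists_syzygy_factor {N : C} {Y : Db C} (s : (singleDb C).obj N ⟶ Y)
    (hs : (perf C).trW s) :
    ∃ (Z : Db C) (s' : Y ⟶ Z), (perf C).trW (s ≫ s') ∧ ∀ M : C, HigherExtVanishes M →
        (∀ x : (singleDb C).obj M ⟶ Z, ∃ u, x = u ≫ s ≫ s') ∧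
        ∀ u : (singleDb C).obj M ⟶ (singleDb C).obj N, u ≫ s ≫ s' = 0 →
          ∃ (Q : C) (_ : Projective Q) (a : (singleDb C).obj M ⟶ (singleDb C).obj Q) (b : Q ⟶ N),
            u = a ≫ (singleDb C).map b := by
  obtain ⟨P, p, q, hT, hP⟩ := hs
  obtain ⟨k, hk⟩ := exists_eq_zero_of_perf _ ((perf C).le_shift (-1) _ hP)
  obtain ⟨N', δ, h1, h2⟩ := exists_syzygy N k _ rfl
  obtain ⟨s', hs'⟩ := Pretriangulated.Triangle.yoneda_exact₂ _
    (Pretriangulated.inv_rot_of_distTriang _ hT) δ (hk N' _)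
  have hs'' : δ = s ≫ s' := hs'
  subst hs''
  exact ⟨_, s', h1, h2⟩

/-- If the higher extensions of `M` by projectives vanish, every morphism from `M` in the
singularity category comes from a morphism of objects. -/
lemma HigherExtVanishes.exists_map_eq {M N : C} (hM : HigherExtVanishes M)
    (x : (toDsing C).obj ((singleDb C).obj M) ⟶ (toDsing C).obj ((singleDb C).obj N)) :
    ∃ u : M ⟶ N, (toDsing C).map ((singleDb C).map u) = x := by
  obtain ⟨φ, rfl⟩ := Localization.exists_leftFraction (toDsing C) (perf C).trW x
  obtain ⟨Z, s', h1, h2⟩ := exists_syzygy_factor φ.s φ.hs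
  obtain ⟨u, hu⟩ := (h2 M hM).1 (φ.f ≫ s')
  obtain ⟨u, rfl⟩ := (singleDb C).map_surjective u
  have hs : IsIso ((toDsing C).map φ.s) := Localization.inverts _ (perf C).trW _ φ.hs
  have hss' : IsIso ((toDsing C).map (φ.s ≫ s')) := Localization.inverts _ (perf C).trW _ h1
  have hs' : IsIso ((toDsing C).map s') := by
    rw [Functor.map_comp] at hss'
    exact IsIso.of_isIso_comp_left ((toDsing C).map φ.s) _
  refine ⟨u, ?_⟩
  rw [← cancel_mono ((toDsing C).map φ.s), MorphismProperty.LeftFraction.map_comp_map_s,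
    ← cancel_mono ((toDsing C).map s'), Category.assoc, ← Functor.map_comp, ← Functor.map_comp,
    ← Functor.map_comp, hu]

/-- If the higher extensions of `M` by projectives vanish, a morphism from `M` that is zero in the
singularity category factors through a projective object. -/
lemma HigherExtVanishes.exists_factor {M N : C} (hM : HigherExtVanishes M) (u : M ⟶ N)
    (hu : (toDsing C).map ((singleDb C).map u) = 0) :
    ∃ (Q : C) (_ : Projective Q) (a : M ⟶ Q) (b : Q ⟶ N), u = a ≫ b := by
  rw [← (toDsing C).map_zero, MorphismProperty.map_eq_iff_postcomp (toDsing C) (perf C).trW] at hu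
  obtain ⟨Y, s, hs, h0⟩ := hu
  obtain ⟨Z, s', -, h2⟩ := exists_syzygy_factor s hs
  obtain ⟨Q, hQ, a, b, hab⟩ := (h2 M hM).2 ((singleDb C).map u) (by
    rw [← Category.assoc, h0, zero_comp, zero_comp])
  obtain ⟨a, rfl⟩ := (singleDb C).map_surjective a
  exact ⟨Q, hQ, a, b, (singleDb C).map_injective (by rw [hab, Functor.map_comp])⟩

end SingularityCategory

/-! ### Matrix factorizations and the singularity category -/

section MatrixLemmas

lemma exists_mk_eq {A : Type*} [CommRing A] (I : Ideal A) {ι : Type*} (z : ι → A ⧸ I) :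
    ∃ v : ι → A, (fun i => Ideal.Quotient.mk I (v i)) = z :=
  ⟨fun i => (Ideal.Quotient.mk_surjective (z i)).choose,
    funext fun i => (Ideal.Quotient.mk_surjective (z i)).choose_spec⟩

variable {A : Type u} [CommRing A] {𝒜 : ℤ → AddSubgroup A} {f : A} {h : ℤ}
variable {ι κ : Type}

lemma matrix_smul_cancel (hf0 : f ∈ nonZeroDivisors A) {m n : Matrix κ ι A}
    (hmn : f • m = f • n) : m = n := by
  ext i j
  have := congrFun (congrFun hmn i) j
  simp only [Matrix.smul_apply, smul_eq_mul] at this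
  exact (mul_cancel_left_mem_nonZeroDivisors hf0).1 this

namespace MatFac

lemma φ_cancel_left (hf0 : f ∈ nonZeroDivisors A) (E : MatFac 𝒜 f h) {m n : Matrix E.ι ι A}
    (hmn : E.φ * m = E.φ * n) : m = n := by
  apply matrix_smul_cancel hf0
  have := congrArg (E.ψ * ·) hmn
  simpa [← Matrix.mul_assoc, E.ψ_mul_φ] using this

/-- A matrix killed by `ψ` modulo `f` is a multiple of `φ`. -/
lemma eq_mul_φ (hf0 : f ∈ nonZeroDivisors A) (E : MatFac 𝒜 f h) {m n : Matrix ι E.ι A}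
    (hmn : m * E.ψ = f • n) : m = n * E.φ := by
  apply matrix_smul_cancel hf0
  have := congrArg (· * E.φ) hmn
  simpa [Matrix.mul_assoc, E.ψ_mul_φ] using this

/-- A matrix killed by `φ` modulo `f` is a multiple of `ψ`. -/
lemma eq_mul_ψ (hf0 : f ∈ nonZeroDivisors A) (E : MatFac 𝒜 f h) {m n : Matrix ι E.ι A}
    (hmn : m * E.φ = f • n) : m = n * E.ψ := by
  apply matrix_smul_cancel hf0
  have := congrArg (· * E.ψ) hmn
  simpa [Matrix.mul_assoc, E.φ_mul_ψ] using this

/-- The matrix factorization `(ψ, φ)`: `M₁` and `M₀(-h)` take the places of `M₀` and `M₁`. -/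
def swap (E : MatFac 𝒜 f h) : MatFac 𝒜 f h where
  ι := E.ι
  d := E.e
  e := fun i => E.d i - h
  φ := E.ψ
  ψ := E.φ
  φ_mem := E.ψ_mem
  ψ_mem i j := by
    have := E.φ_mem i j
    rwa [show E.d i - E.e j = E.d i - h - (E.e j - h) by ring] at this
  φ_mul_ψ := E.ψ_mul_φ
  ψ_mul_φ := E.φ_mul_ψ

end MatFac

/-- A homogeneous multiple of a homogeneous non-zero-divisor `f` is `f` times a homogeneous
element. -/
lemma mem_of_mul_mem [GradedRing 𝒜] (hf : f ∈ 𝒜 h) (hf0 : f ∈ nonZeroDivisors A) {n : ℤ} {x : A}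
    (hx : f * x ∈ 𝒜 n) : x ∈ 𝒜 (n - h) := by
  have h1 := gproj_mul 𝒜 (DirectSum.Decomposition.isInternal 𝒜) hf n x
  rw [gproj_same _ hx, mul_cancel_left_mem_nonZeroDivisors hf0] at h1
  rw [h1]
  exact gproj_mem _ _ _

end MatrixLemmas

section BarMap

variable {A : Type u} [CommRing A] {𝒜 : ℤ → AddSubgroup A} [GradedRing 𝒜] {f : A} {h : ℤ}
  (hf : f ∈ 𝒜 h)
variable {ι κ : Type} [Fintype ι] [DecidableEq ι] [Fintype κ] [DecidableEq κ]

/-- Every morphism between graded free modules over `A / (f)` is given by a matrix over `A`. -/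
lemma exists_barMap_eq {b : ι → ℤ} {c : κ → ℤ} (x : freeBar 𝒜 hf b ⟶ freeBar 𝒜 hf c) :
    ∃ (m : Matrix κ ι A) (hm : ∀ i j, m i j ∈ 𝒜 (c i - b j)), barMap 𝒜 hf m hm = x := by
  have hex : ∀ k i, ∃ y ∈ 𝒜 (c k - b i), Ideal.Quotient.mk (Ideal.span {f}) y =
      (GrModFG.lin x (Pi.single i 1 : ι → A ⧸ Ideal.span {f}) : κ → A ⧸ Ideal.span {f}) k := by
    intro k i
    have h1 : (Pi.single i 1 : ι → A ⧸ Ideal.span {f}) ∈ (freeBar 𝒜 hf b).deg (-b i) := by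
      intro j
      by_cases hij : j = i
      · subst hij
        rw [Pi.single_eq_same, neg_add_cancel]
        exact SetLike.GradedOne.one_mem
      · rw [Pi.single_eq_of_ne hij]
        exact zero_mem _
    obtain ⟨y, hy, hy'⟩ := GrModFG.lin_mem x h1 k
    refine ⟨y, ?_, hy'⟩
    rwa [show c k - b i = -b i + c k by ring]
  choose m hm hm' using hex
  refine ⟨m, hm, GrModFG.hom_ext fun v => ?_⟩
  have h2 : (v : ι → A ⧸ Ideal.span {f}) =
      ∑ i, (v : ι → A ⧸ Ideal.span {f}) i • (Pi.single i 1 : ι → A ⧸ Ideal.span {f}) :=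
    pi_eq_sum_univ' v
  have h3 : GrModFG.lin x v = ∑ i, (v : ι → A ⧸ Ideal.span {f}) i •
      (GrModFG.lin x (Pi.single i 1 : ι → A ⧸ Ideal.span {f}) : κ → A ⧸ Ideal.span {f}) := by
    refine (congrArg (GrModFG.lin x) h2).trans ?_
    exact (map_sum (GrModFG.lin x) _ _).trans
      (Finset.sum_congr rfl fun i _ => map_smul (GrModFG.lin x) _ _)
  refine Eq.trans ?_ h3.symm
  funext k
  refine Eq.trans ?_ (Finset.sum_apply (M := fun _ : κ => A ⧸ Ideal.span {f}) k Finset.univ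
    fun i => (v : ι → A ⧸ Ideal.span {f}) i • (GrModFG.lin x
      (Pi.single i 1 : ι → A ⧸ Ideal.span {f}) : κ → A ⧸ Ideal.span {f})).symm
  change ∑ i, Ideal.Quotient.mk (Ideal.span {f}) (m k i) * (v : ι → A ⧸ Ideal.span {f}) i = _
  refine Finset.sum_congr rfl fun i _ => ?_
  rw [hm', mul_comm]
  rfl

/-- Two matrices induce the same morphism modulo `f` only if they differ by a homogeneous multiple
of `f`. -/
lemma exists_sub_eq_smul (hf0 : f ∈ nonZeroDivisors A) {b : ι → ℤ} {c : κ → ℤ}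
    {m n : Matrix κ ι A} (hm : ∀ i j, m i j ∈ 𝒜 (c i - b j)) (hn : ∀ i j, n i j ∈ 𝒜 (c i - b j))
    (hmn : barMap 𝒜 hf m hm = barMap 𝒜 hf n hn) :
    ∃ γ : Matrix κ ι A, m - n = f • γ ∧ ∀ i j, γ i j ∈ 𝒜 (c i - b j - h) := by
  have hex : ∀ k i, ∃ y, m k i - n k i = f * y := by
    intro k i
    have h1 := LinearMap.congr_fun (congrArg GrModFG.lin hmn)
      (Pi.single i 1 : ι → A ⧸ Ideal.span {f})
    have h2 : Matrix.mulVec (m.map (Ideal.Quotient.mk (Ideal.span {f}))) (Pi.single i 1) =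
      Matrix.mulVec (n.map (Ideal.Quotient.mk (Ideal.span {f}))) (Pi.single i 1) := h1
    rw [Matrix.mulVec_single_one, Matrix.mulVec_single_one] at h2
    have h3 : Ideal.Quotient.mk (Ideal.span {f}) (m k i) =
      Ideal.Quotient.mk (Ideal.span {f}) (n k i) := congrFun h2 k
    rw [Ideal.Quotient.eq, Ideal.mem_span_singleton] at h3
    exact h3
  choose γ hγ using hex
  refine ⟨γ, ?_, fun i j => mem_of_mul_mem hf hf0 ?_⟩
  · ext i j
    exact hγ i j
  · rw [← hγ]
    exact sub_mem (hm i j) (hn i j)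

lemma exists_eq_smul_of_barMap_eq_zero (hf0 : f ∈ nonZeroDivisors A) {b : ι → ℤ} {c : κ → ℤ}
    {m : Matrix κ ι A} (hm : ∀ i j, m i j ∈ 𝒜 (c i - b j)) (h0 : barMap 𝒜 hf m hm = 0) :
    ∃ γ : Matrix κ ι A, m = f • γ ∧ ∀ i j, γ i j ∈ 𝒜 (c i - b j - h) := by
  obtain ⟨γ, h1, h2⟩ := exists_sub_eq_smul hf hf0 hm (n := 0) (fun _ _ => zero_mem _) (by
    rw [h0]
    refine GrModFG.hom_ext fun v => ?_
    change (0 : κ → A ⧸ Ideal.span {f}) =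
      Matrix.mulVec ((0 : Matrix κ ι A).map (Ideal.Quotient.mk _)) (v : ι → A ⧸ Ideal.span {f})
    rw [Matrix.map_zero _ (map_zero _)]
    exact (Matrix.zero_mulVec _).symm)
  exact ⟨γ, by rw [← h1, sub_zero], h2⟩

end BarMap

section Cokernel

variable {B : Type u} [CommRing B] {ℬ : ℤ → AddSubgroup B}

lemma cokernel_π_eq_zero {X Y : GrModFG ℬ} (x : X ⟶ Y) {y : Y}
    (hy : GrModFG.lin (cokernel.π x) y = 0) : ∃ z, GrModFG.lin x z = y := by
  rw [← GrModFG.cokerπ_eq_zero]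
  have h1 : cokernel.π x ≫ cokernel.desc x _ (GrModFG.comp_cokerπ x) = GrModFG.cokerπ x :=
    cokernel.π_desc _ _ _
  rw [← h1, GrModFG.lin_comp, LinearMap.comp_apply, hy, map_zero]

end Cokernel

section Stabilization

variable {A : Type u} [CommRing A] {𝒜 : ℤ → AddSubgroup A} [GradedRing 𝒜] {f : A} {h : ℤ}
  (hf : f ∈ 𝒜 h)

/-- The projection of `⨁ i, Ā(d i)` to the cokernel of `φ̄`. -/
noncomputable def cokerPi (E : MatFac 𝒜 f h) :
    freeBar 𝒜 hf E.d ⟶ (cokerFunctor 𝒜 hf).obj E :=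
  cokernel.π (barMap 𝒜 hf E.φ E.φ_mem)

instance (E : MatFac 𝒜 f h) : Epi (cokerPi hf E) :=
  inferInstanceAs (Epi (cokernel.π (barMap 𝒜 hf E.φ E.φ_mem)))

lemma barMap_comp_cokerPi (E : MatFac 𝒜 f h) : barMap 𝒜 hf E.φ E.φ_mem ≫ cokerPi hf E = 0 :=
  cokernel.condition _

lemma cokerPi_surjective (E : MatFac 𝒜 f h) : Function.Surjective (GrModFG.lin (cokerPi hf E)) :=
  GrModFG.surjective_of_epi _

lemma exists_of_cokerPi_eq_zero (E : MatFac 𝒜 f h) {y : freeBar 𝒜 hf E.d}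
    (hy : GrModFG.lin (cokerPi hf E) y = 0) :
    ∃ z, GrModFG.lin (barMap 𝒜 hf E.φ E.φ_mem) z = y :=
  cokernel_π_eq_zero _ hy

/-- The morphism out of the cokernel of `φ̄` induced by a morphism that kills `φ̄`. -/
noncomputable def cokerDesc (E : MatFac 𝒜 f h) {X : GrModFG (quotGrading 𝒜 f)}
    (x : freeBar 𝒜 hf E.d ⟶ X) (hx : barMap 𝒜 hf E.φ E.φ_mem ≫ x = 0) :
    (cokerFunctor 𝒜 hf).obj E ⟶ X :=
  cokernel.desc _ x hx

lemma cokerPi_desc (E : MatFac 𝒜 f h) {X : GrModFG (quotGrading 𝒜 f)}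
    (x : freeBar 𝒜 hf E.d ⟶ X) (hx : barMap 𝒜 hf E.φ E.φ_mem ≫ x = 0) :
    cokerPi hf E ≫ cokerDesc hf E x hx = x :=
  cokernel.π_desc _ _ _

lemma cokerPi_map {E E' : MatFac 𝒜 f h} (a : E ⟶ E') :
    cokerPi hf E ≫ (cokerFunctor 𝒜 hf).map a =
      barMap 𝒜 hf (MatFac.Hom.α a) (MatFac.Hom.α_mem a) ≫ cokerPi hf E' :=
  cokernel.π_desc _ _ _

lemma barMap_ψ_comp_φ (E : MatFac 𝒜 f h) :
    barMap 𝒜 hf E.ψ E.ψ_mem ≫ barMap 𝒜 hf E.φ E.φ_mem = 0 :=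
  (barMap_comp hf E.ψ E.φ E.ψ_mem E.φ_mem).trans
    ((barMap_congr hf E.φ_mul_ψ _).trans (barMap_eq_zero hf _))

/-- The sequence `M₀(-h) → M₁ → M₀` is exact modulo `f`. -/
lemma exists_of_barMap_eq_zero (hf0 : f ∈ nonZeroDivisors A) (E : MatFac 𝒜 f h)
    {y : freeBar 𝒜 hf E.e} (hy : GrModFG.lin (barMap 𝒜 hf E.φ E.φ_mem) y = 0) :
    ∃ z, GrModFG.lin (barMap 𝒜 hf E.ψ E.ψ_mem) z = y := by
  obtain ⟨v, rfl⟩ := exists_mk_eq _ y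
  have h1 : ∀ i, ∃ u, E.φ.mulVec v i = f * u := by
    intro i
    rw [← dvd_def, ← Ideal.mem_span_singleton, ← Ideal.Quotient.eq_zero_iff_mem]
    exact (RingHom.map_mulVec (Ideal.Quotient.mk (Ideal.span {f})) E.φ v i).trans (congrFun hy i)
  choose u hu using h1
  have h2 : v = E.ψ.mulVec u := by
    funext i
    rw [← mul_cancel_left_mem_nonZeroDivisors hf0]
    have h3 : E.ψ.mulVec (E.φ.mulVec v) = E.ψ.mulVec (f • u) := by
      congr 1
      exact funext hu
    rw [Matrix.mulVec_mulVec, E.ψ_mul_φ, Matrix.smul_mulVec, Matrix.one_mulVec,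
      Matrix.mulVec_smul] at h3
    exact congrFun h3 i
  refine ⟨fun i => Ideal.Quotient.mk (Ideal.span {f}) (u i), ?_⟩
  subst h2
  exact funext fun i => (RingHom.map_mulVec (Ideal.Quotient.mk (Ideal.span {f})) E.ψ u i).symm

/-- The projection of `M₁` to the cokernel of `ψ̄`. -/
noncomputable def swapPi (E : MatFac 𝒜 f h) :
    freeBar 𝒜 hf E.e ⟶ (cokerFunctor 𝒜 hf).obj E.swap :=
  cokerPi hf E.swap

instance (E : MatFac 𝒜 f h) : Epi (swapPi hf E) :=
  inferInstanceAs (Epi (cokerPi hf E.swap))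

lemma barMap_comp_swapPi (E : MatFac 𝒜 f h) : barMap 𝒜 hf E.ψ E.ψ_mem ≫ swapPi hf E = 0 :=
  barMap_comp_cokerPi hf E.swap

/-- The inclusion of the cokernel of `ψ̄` into `M₀`, induced by `φ̄`. -/
noncomputable def syzygyι (E : MatFac 𝒜 f h) :
    (cokerFunctor 𝒜 hf).obj E.swap ⟶ freeBar 𝒜 hf E.d :=
  cokerDesc hf E.swap (barMap 𝒜 hf E.φ E.φ_mem) (barMap_ψ_comp_φ hf E)

lemma swapPi_comp_syzygyι (E : MatFac 𝒜 f h) :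
    swapPi hf E ≫ syzygyι hf E = barMap 𝒜 hf E.φ E.φ_mem :=
  cokerPi_desc hf E.swap _ (barMap_ψ_comp_φ hf E)

lemma syzygyι_comp_cokerPi (E : MatFac 𝒜 f h) : syzygyι hf E ≫ cokerPi hf E = 0 := by
  rw [← cancel_epi (swapPi hf E), ← Category.assoc, swapPi_comp_syzygyι, comp_zero,
    barMap_comp_cokerPi]

variable [IsNoetherianRing A]

/-- The first syzygy of the cokernel of `φ̄` is the cokernel of `ψ̄`. -/
lemma shortExact_syzygy (hf0 : f ∈ nonZeroDivisors A) (E : MatFac 𝒜 f h) :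
    (ShortComplex.mk _ _ (syzygyι_comp_cokerPi hf E)).ShortExact := by
  have hd : ∀ y, GrModFG.lin (syzygyι hf E) (GrModFG.lin (swapPi hf E) y) =
      GrModFG.lin (barMap 𝒜 hf E.φ E.φ_mem) y := fun y =>
    LinearMap.congr_fun (congrArg GrModFG.lin (swapPi_comp_syzygyι hf E)) y
  have hinj : Function.Injective (GrModFG.lin (syzygyι hf E)) := by
    rw [injective_iff_map_eq_zero]
    intro x hx
    obtain ⟨y, rfl⟩ : ∃ y, GrModFG.lin (swapPi hf E) y = x := cokerPi_surjective hf E.swap x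
    rw [hd] at hx
    obtain ⟨z, rfl⟩ := exists_of_barMap_eq_zero hf hf0 E hx
    exact LinearMap.congr_fun (congrArg GrModFG.lin (barMap_comp_swapPi hf E)) z
  exact
    { exact := ShortComplex.exact_of_f_is_kernel _ (GrModFG.isLimitOfExact _ _ _ hinj fun x hx => by
        obtain ⟨z, rfl⟩ := exists_of_cokerPi_eq_zero hf E hx
        exact ⟨_, hd z⟩)
      mono_f := GrModFG.mono_of_injective _ hinj
      epi_g := inferInstanceAs (Epi (cokerPi hf E)) }

/-- Every morphism from the cokernel of `ψ̄` to a projective module extends to `M₀`: a matrix killed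
by `ψ` modulo `f` is a multiple of `φ`. -/
lemma exists_extension (hf0 : f ∈ nonZeroDivisors A) (E : MatFac 𝒜 f h)
    (Q : GrModFG (quotGrading 𝒜 f)) [Projective Q] (x : (cokerFunctor 𝒜 hf).obj E.swap ⟶ Q) :
    ∃ y : freeBar 𝒜 hf E.d ⟶ Q, x = syzygyι hf E ≫ y := by
  obtain ⟨n, c, p, hp⟩ := GrModFG.exists_free_epi
    (isInternal_quotGrading 𝒜 (DirectSum.Decomposition.isInternal 𝒜) hf) Q
  let s : Q ⟶ freeBar 𝒜 hf c := Projective.factorThru (𝟙 Q) p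
  have hs : s ≫ p = 𝟙 Q := Projective.factorThru_comp _ _
  obtain ⟨m, hm, hmx⟩ := exists_barMap_eq hf (swapPi hf E ≫ x ≫ s)
  have h0 : barMap 𝒜 hf E.ψ E.ψ_mem ≫ barMap 𝒜 hf m hm = 0 := by
    rw [hmx, ← Category.assoc, barMap_comp_swapPi, zero_comp]
  rw [barMap_comp] at h0
  obtain ⟨γ, hγ, hγ'⟩ := exists_eq_smul_of_barMap_eq_zero hf hf0 _ h0
  obtain rfl : m = γ * E.φ := E.eq_mul_φ hf0 hγ
  have hγ'' : ∀ i j, γ i j ∈ 𝒜 (c i - E.d j) := fun i j => by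
    have := hγ' i j
    rwa [show c i - (E.d j - h) - h = c i - E.d j by ring] at this
  refine ⟨barMap 𝒜 hf γ hγ'' ≫ p, ?_⟩
  have h1 : syzygyι hf E ≫ barMap 𝒜 hf γ hγ'' = x ≫ s := by
    rw [← cancel_epi (swapPi hf E), ← hmx, ← Category.assoc, swapPi_comp_syzygyι, barMap_comp]
  rw [← Category.assoc, h1, Category.assoc, hs, Category.comp_id]

/-- The cokernel of a matrix factorization has no higher extensions by projective modules. -/
lemma higherExtVanishes_coker (hf0 : f ∈ nonZeroDivisors A) (E : MatFac 𝒜 f h) :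
    HigherExtVanishes ((cokerFunctor 𝒜 hf).obj E) := by
  refine higherExtVanishes_of_class (fun M => ∃ E : MatFac 𝒜 f h, (cokerFunctor 𝒜 hf).obj E = M)
    ?_ ⟨E, rfl⟩
  rintro _ ⟨E, rfl⟩
  exact ⟨_, shortExact_syzygy hf hf0 E, ⟨E.swap, rfl⟩,
    inferInstanceAs (Projective (freeBar 𝒜 hf E.d)), rfl,
    fun Q _ x => exists_extension hf hf0 E Q x⟩

/-- A morphism from a projective module to `M₀` that vanishes in the cokernel of `φ̄` factors
through `φ̄`. -/
lemma exists_lift_φ (E : MatFac 𝒜 f h) {Q : GrModFG (quotGrading 𝒜 f)} [Projective Q]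
    (x : Q ⟶ freeBar 𝒜 hf E.d) (hx : x ≫ cokerPi hf E = 0) :
    ∃ y : Q ⟶ freeBar 𝒜 hf E.e, y ≫ barMap 𝒜 hf E.φ E.φ_mem = x := by
  have hS : (ShortComplex.mk _ _ (barMap_comp_cokerPi hf E)).Exact :=
    ShortComplex.exact_cokernel (barMap 𝒜 hf E.φ E.φ_mem)
  exact ⟨hS.liftFromProjective x hx, hS.liftFromProjective_comp x hx⟩

/-- Every morphism between cokernels comes from a morphism of matrix factorizations. -/
lemma exists_cokerFunctor_map_eq (hf0 : f ∈ nonZeroDivisors A) {E E' : MatFac 𝒜 f h}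
    (u : (cokerFunctor 𝒜 hf).obj E ⟶ (cokerFunctor 𝒜 hf).obj E') :
    ∃ a : E ⟶ E', (cokerFunctor 𝒜 hf).map a = u := by
  obtain ⟨α, hα, hαu⟩ := exists_barMap_eq hf
    (Projective.factorThru (cokerPi hf E ≫ u) (cokerPi hf E'))
  have h1 : barMap 𝒜 hf α hα ≫ cokerPi hf E' = cokerPi hf E ≫ u := by
    rw [hαu]
    exact Projective.factorThru_comp _ _
  obtain ⟨y, hy⟩ := exists_lift_φ hf E' (barMap 𝒜 hf E.φ E.φ_mem ≫ barMap 𝒜 hf α hα) (by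
    rw [Category.assoc, h1, ← Category.assoc, barMap_comp_cokerPi, zero_comp])
  obtain ⟨β, hβ, rfl⟩ := exists_barMap_eq hf y
  rw [barMap_comp, barMap_comp] at hy
  obtain ⟨γ, hγ, hγ'⟩ := exists_sub_eq_smul hf hf0 _ _ hy.symm
  -- The lift `β` commutes with `φ` only modulo `f`; the error `f γ = φ (ψ γ)` is absorbed in `β`.
  have hβγ : ∀ i j, (β + E'.ψ * γ) i j ∈ 𝒜 (E'.e i - E.e j) := fun i j =>
    add_mem (hβ i j) (MatFac.mul_mem (c := fun k => E'.d k - h) E'.ψ_mem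
      (fun i j => by
        have := hγ' i j
        rwa [show E'.d i - E.e j - h = E'.d i - h - E.e j by ring] at this) i j)
  have hφ : α * E.φ = E'.φ * (β + E'.ψ * γ) := by
    rw [Matrix.mul_add, ← Matrix.mul_assoc, E'.φ_mul_ψ, Matrix.smul_mul, Matrix.one_mul, ← hγ]
    abel
  have hψ : (β + E'.ψ * γ) * E.ψ = E'.ψ * α := by
    apply E'.φ_cancel_left hf0
    rw [← Matrix.mul_assoc, ← hφ, Matrix.mul_assoc, E.φ_mul_ψ, ← Matrix.mul_assoc, E'.φ_mul_ψ]
    simp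
  refine ⟨⟨α, β + E'.ψ * γ, hα, hβγ, hφ, hψ⟩, ?_⟩
  rw [← cancel_epi (cokerPi hf E), cokerPi_map, ← h1]

/-- Two morphisms of matrix factorizations are homotopic if the induced morphisms between the
cokernels differ by a morphism that factors through a projective module. -/
lemma homotopic_of_factor (hf0 : f ∈ nonZeroDivisors A) {E E' : MatFac 𝒜 f h} (a b : E ⟶ E')
    (Q : GrModFG (quotGrading 𝒜 f)) [Projective Q] (u : (cokerFunctor 𝒜 hf).obj E ⟶ Q)
    (v : Q ⟶ (cokerFunctor 𝒜 hf).obj E')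
    (huv : (cokerFunctor 𝒜 hf).map a - (cokerFunctor 𝒜 hf).map b = u ≫ v) :
    MatFac.homotopic 𝒜 f h a b := by
  obtain ⟨n, c, p, hp⟩ := GrModFG.exists_free_epi
    (isInternal_quotGrading 𝒜 (DirectSum.Decomposition.isInternal 𝒜) hf) Q
  obtain ⟨m, hm, hmu⟩ := exists_barMap_eq hf (cokerPi hf E ≫ u ≫ Projective.factorThru (𝟙 Q) p)
  obtain ⟨l, hl, hlv⟩ := exists_barMap_eq hf (Projective.factorThru (p ≫ v) (cokerPi hf E'))
  have hlv' : barMap 𝒜 hf l hl ≫ cokerPi hf E' = p ≫ v := by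
    rw [hlv]
    exact Projective.factorThru_comp _ _
  have h0 : barMap 𝒜 hf E.φ E.φ_mem ≫ barMap 𝒜 hf m hm = 0 := by
    rw [hmu, ← Category.assoc, barMap_comp_cokerPi, zero_comp]
  rw [barMap_comp] at h0
  obtain ⟨ρ, hρ, hρ'⟩ := exists_eq_smul_of_barMap_eq_zero hf hf0 _ h0
  obtain rfl : m = ρ * E.ψ := E.eq_mul_ψ hf0 hρ
  let δ := MatFac.Hom.α a - MatFac.Hom.α b
  have hδ : ∀ i j, δ i j ∈ 𝒜 (E'.d i - E.d j) := fun i j =>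
    sub_mem (MatFac.Hom.α_mem a i j) (MatFac.Hom.α_mem b i j)
  have hlm := MatFac.mul_mem hl hm
  -- `δ` and the matrix `l ρ ψ` of `u ≫ v` induce the same morphism to the cokernel of `φ̄`.
  have hε : ∀ i j, (δ - l * (ρ * E.ψ)) i j ∈ 𝒜 (E'.d i - E.d j) := fun i j =>
    sub_mem (hδ i j) (hlm i j)
  have h1 : barMap 𝒜 hf (δ - l * (ρ * E.ψ)) hε ≫ cokerPi hf E' = 0 := by
    have e1 : barMap 𝒜 hf (δ - l * (ρ * E.ψ)) hε + barMap 𝒜 hf (l * (ρ * E.ψ)) hlm +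
        barMap 𝒜 hf (MatFac.Hom.α b) (MatFac.Hom.α_mem b) =
          barMap 𝒜 hf (MatFac.Hom.α a) (MatFac.Hom.α_mem a) := by
      rw [← barMap_add hf _ _ hε hlm, ← barMap_add hf (δ - l * (ρ * E.ψ) + l * (ρ * E.ψ)) _
        (fun i j => add_mem (hε i j) (hlm i j)) (MatFac.Hom.α_mem b)]
      exact barMap_congr hf (by simp [δ]) _
    have e2 : barMap 𝒜 hf (l * (ρ * E.ψ)) hlm ≫ cokerPi hf E' = cokerPi hf E ≫ u ≫ v := by
      rw [← barMap_comp hf _ _ hm hl, Category.assoc, hlv', hmu]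
      have e3 : Projective.factorThru (𝟙 Q) p ≫ p = 𝟙 Q := Projective.factorThru_comp _ _
      simp only [Category.assoc, reassoc_of% e3]
    have e4 := congrArg (· ≫ cokerPi hf E') e1
    simp only [Preadditive.add_comp] at e4
    rw [e2, ← huv, ← cokerPi_map, ← cokerPi_map, Preadditive.comp_sub] at e4
    rw [← sub_eq_zero] at e4
    rw [← e4]
    abel
  obtain ⟨y, hy⟩ := exists_lift_φ hf E' _ h1
  obtain ⟨ξ, hξ, rfl⟩ := exists_barMap_eq hf y
  rw [barMap_comp] at hy
  obtain ⟨γ, hγ, hγ'⟩ := exists_sub_eq_smul hf hf0 _ _ hy.symm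
  have hα : δ = E'.φ * (ξ + E'.ψ * γ) + (l * ρ) * E.ψ := by
    rw [Matrix.mul_add, ← Matrix.mul_assoc, E'.φ_mul_ψ, Matrix.smul_mul, Matrix.one_mul, ← hγ,
      Matrix.mul_assoc]
    abel
  refine ⟨ξ + E'.ψ * γ, l * ρ, fun i j => add_mem (hξ i j) (MatFac.mul_mem
    (c := fun k => E'.d k - h) E'.ψ_mem (fun i j => ?_) i j), fun i j => ?_, hα, ?_⟩
  · have := hγ' i j
    rwa [show E'.d i - E.d j - h = E'.d i - h - E.d j by ring] at this
  · refine MatFac.mul_mem (d := fun i => E'.d i - h) (c := fun i => c i - h) (fun i j => ?_)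
      (fun i j => ?_) i j
    · have := hl i j
      rwa [show E'.d i - c j = E'.d i - h - (c j - h) by ring] at this
    · have := hρ' i j
      rwa [show c i - E.e j - h = c i - h - E.e j by ring] at this
  · apply E'.φ_cancel_left hf0
    have hα' : (MatFac.Hom.α a - MatFac.Hom.α b) * E.φ =
        (E'.φ * (ξ + E'.ψ * γ) + (l * ρ) * E.ψ) * E.φ := congrArg (· * E.φ) hα
    have hf' : E'.φ * (E'.ψ * (l * ρ)) = l * (ρ * f • (1 : Matrix E.ι E.ι A)) := by
      rw [← Matrix.mul_assoc, E'.φ_mul_ψ]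
      simp
    rw [Matrix.mul_sub, ← MatFac.Hom.comm_φ a, ← MatFac.Hom.comm_φ b, ← Matrix.sub_mul, hα']
    simp only [Matrix.add_mul, Matrix.mul_add, Matrix.mul_assoc, E.ψ_mul_φ]
    rw [hf', add_comm]

lemma enoughProjectives_quotGrading (hf : f ∈ 𝒜 h) :
    EnoughProjectives (GrModFG (quotGrading 𝒜 f)) :=
  GrModFG.enoughProjectives (isInternal_quotGrading 𝒜 (DirectSum.Decomposition.isInternal 𝒜) hf)

/-- The functor `(φ, ψ) ↦ coker φ̄` to the singularity category is full for every non-zero-divisor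
`f`, without regularity of the ring. -/
lemma stab_full (hf0 : f ∈ nonZeroDivisors A) : (stab 𝒜 hf).Full where
  map_surjective {E E'} x := by
    have := enoughProjectives_quotGrading hf
    obtain ⟨u, hu⟩ := (higherExtVanishes_coker hf hf0 E.as).exists_map_eq
      (N := (cokerFunctor 𝒜 hf).obj E'.as) x
    obtain ⟨a, rfl⟩ := exists_cokerFunctor_map_eq hf hf0 u
    exact ⟨(toHmf 𝒜 f h).map a, hu⟩

/-- The functor `(φ, ψ) ↦ coker φ̄` to the singularity category is faithful for every
non-zero-divisor `f`, without regularity of the ring. -/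
lemma stab_faithful (hf0 : f ∈ nonZeroDivisors A) : (stab 𝒜 hf).Faithful where
  map_injective {E E'} x y hxy := by
    have := enoughProjectives_quotGrading hf
    obtain ⟨a, rfl⟩ := (toHmf 𝒜 f h).map_surjective x
    obtain ⟨b, rfl⟩ := (toHmf 𝒜 f h).map_surjective y
    have h1 : (toDsing _).map ((singleDb _).map ((cokerFunctor 𝒜 hf).map a)) =
      (toDsing _).map ((singleDb _).map ((cokerFunctor 𝒜 hf).map b)) := hxy
    obtain ⟨Q, hQ, u, v, huv⟩ := (higherExtVanishes_coker hf hf0 E.as).exists_factor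
      ((cokerFunctor 𝒜 hf).map a - (cokerFunctor 𝒜 hf).map b) (by
        rw [Functor.map_sub, Functor.map_sub, h1, sub_self])
    exact CategoryTheory.Quotient.sound _ (homotopic_of_factor hf hf0 a b Q u v huv)

end Stabilization

/-! ### The push-forward of a matrix factorization -/

section PushForwardDerived

variable {C : Type u} [Category.{v} C] [Abelian C] [HasDerivedCategory.{w} C]

/-- An epimorphism with projective kernel is an isomorphism in the singularity category. -/
lemma isIso_toDsing_map {S : ShortComplex C} (hS : S.ShortExact) [Projective S.X₁] :
    IsIso ((toDsing C).map ((singleDb C).map S.g)) := by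
  obtain ⟨δ, hδ⟩ := exists_distinguished_singleDb hS
  exact Localization.inverts _ (perf C).trW _
    (((perf C).trW_iff_of_distinguished' _ hδ).2 (perfD_single C S.X₁ 0))

variable {D : Type u'} [Category.{v'} D] [Abelian D] [HasDerivedCategory.{w'} D]
variable (F : C ⥤ D) [F.Additive] [PreservesFiniteLimits F] [PreservesFiniteColimits F]

/-- The functor induced by an exact functor on bounded derived categories extends it. -/
noncomputable def singleDbCompMapDb : singleDb C ⋙ mapDb F ≅ F ⋙ singleDb D :=
  NatIso.ofComponents
    (fun X => (ObjectProperty.ι _).preimageIso ((F.mapDerivedCategorySingleFunctor 0).app X))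
    (fun {X Y} f => by
      apply (ObjectProperty.ι _).map_injective
      have h (X : C) : (ObjectProperty.ι _).map ((ObjectProperty.ι _).preimageIso
          (X := (mapDb F).obj ((singleDb C).obj X)) (Y := (singleDb D).obj (F.obj X))
          ((F.mapDerivedCategorySingleFunctor 0).app X)).hom =
            (F.mapDerivedCategorySingleFunctor 0).hom.app X := (ObjectProperty.ι _).map_preimage _
      rw [Functor.map_comp, Functor.map_comp]
      refine (congrArg (_ ≫ ·) (h Y)).trans (Eq.trans ?_ (congrArg (· ≫ _) (h X)).symm)
      exact (F.mapDerivedCategorySingleFunctor 0).hom.naturality f)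

end PushForwardDerived

section PushForward

/-- If the first component `φ x + w z` of `φ̃ (x, z)` is divisible by `F`, then so is the second
component `- g x + ψ z`. -/
lemma exists_of_mulVec_eq {R : Type u} [CommRing R] {𝒜 : ℤ → AddSubgroup R} {f : R} {h : ℤ}
    {g : Polynomial R} (hf0 : f ∈ nonZeroDivisors R) (E : MatFac 𝒜 f h)
    (x z u : E.ι → Polynomial R) (hxz : (E.φ.map Polynomial.C).mulVec x +
      (Polynomial.X : Polynomial R) • z = (Polynomial.C f + Polynomial.X * g) • u) :
    ∃ y : E.ι → Polynomial R, -(g • x) + (E.ψ.map Polynomial.C).mulVec z =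
      (Polynomial.C f + Polynomial.X * g) • y := by
  have hφψ : ∀ v, (E.φ.map Polynomial.C).mulVec ((E.ψ.map Polynomial.C).mulVec v) =
      Polynomial.C f • v := by
    intro v
    rw [Matrix.mulVec_mulVec, ← Matrix.map_mul, E.φ_mul_ψ, Matrix.map_smul' _ _ _ (map_mul _),
      Matrix.map_one _ (map_zero _) (map_one _), Matrix.smul_mulVec, Matrix.one_mulVec]
  have hψφ : ∀ v, (E.ψ.map Polynomial.C).mulVec ((E.φ.map Polynomial.C).mulVec v) =
      Polynomial.C f • v := by
    intro v
    rw [Matrix.mulVec_mulVec, ← Matrix.map_mul, E.ψ_mul_φ, Matrix.map_smul' _ _ _ (map_mul _),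
      Matrix.map_one _ (map_zero _) (map_one _), Matrix.smul_mulVec, Matrix.one_mulVec]
  -- Subtracting the value of `ψ̃` at `(u, 0)` makes `φ x + w z` vanish.
  have h1 : (E.φ.map Polynomial.C).mulVec (x - (E.ψ.map Polynomial.C).mulVec u) +
      (Polynomial.X : Polynomial R) • (z - g • u) = 0 := by
    rw [Matrix.mulVec_sub, hφψ, smul_sub, smul_smul]
    rw [add_smul] at hxz
    linear_combination (exp := 1) hxz
  -- The constant coefficient of `x - ψ u` is killed by `φ`, hence by `f`.
  have h2 : ∀ i, ∃ q, (x - (E.ψ.map Polynomial.C).mulVec u) i = Polynomial.X * q := by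
    intro i
    rw [← dvd_def, Polynomial.X_dvd_iff]
    have h3 : E.φ.mulVec (fun j => ((x - (E.ψ.map Polynomial.C).mulVec u) j).coeff 0) = 0 := by
      funext i
      have h4 := congrArg (fun p => Polynomial.coeff p 0) (congrFun h1 i)
      simpa [Matrix.mulVec, dotProduct, Polynomial.finsetSum_coeff, Polynomial.mul_coeff_zero]
        using h4
    have h4 := congrArg E.ψ.mulVec h3
    rw [Matrix.mulVec_mulVec, E.ψ_mul_φ, Matrix.smul_mulVec, Matrix.one_mulVec,
      Matrix.mulVec_zero] at h4
    exact (mem_nonZeroDivisors_iff.1 hf0).1 _ (congrFun h4 i)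
  choose q hq using h2
  have hx : x = (E.ψ.map Polynomial.C).mulVec u + (Polynomial.X : Polynomial R) • q := by
    rw [← sub_eq_iff_eq_add']
    exact funext hq
  have hz : z = g • u - (E.φ.map Polynomial.C).mulVec q := by
    rw [hx, add_sub_cancel_left, Matrix.mulVec_smul, ← smul_add] at h1
    have h3 : (E.φ.map Polynomial.C).mulVec q + (z - g • u) = 0 := by
      funext i
      refine (Polynomial.isRegular_X (R := R)).left ?_
      exact (congrFun h1 i).trans (mul_zero _).symm
    linear_combination (exp := 1) h3
  refine ⟨-q, ?_⟩
  rw [hz, hx, Matrix.mulVec_sub, hψφ, Matrix.mulVec_smul, add_smul, smul_neg, smul_neg, smul_add,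
    smul_smul, mul_comm g]
  abel

variable {R : Type u} [CommRing R] {𝒜 : ℤ → AddSubgroup R} [GradedRing 𝒜]
  {f : R} {h : ℤ} {a : ℤ} {g : Polynomial R}

namespace MatFac

variable (hF : Polynomial.C f + Polynomial.X * g ∈ polyGrading 𝒜 a h)

/-- The morphism `(diag(α, β), diag(β, α))` induced by `(α, β)`. -/
noncomputable def pushHom {E E' : MatFac 𝒜 f h} (x : E ⟶ E') : E.push hF ⟶ E'.push hF :=
  Hom.mk (E := E.push hF) (E' := E'.push hF)
    (Matrix.fromBlocks ((Hom.α x).map Polynomial.C) 0 0 ((Hom.β x).map Polynomial.C))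
    (Matrix.fromBlocks ((Hom.β x).map Polynomial.C) 0 0 ((Hom.α x).map Polynomial.C))
    (by
      rintro (i | i) (j | j)
      · exact C_mem_polyGrading (Hom.α_mem x i j)
      · exact zero_mem _
      · exact zero_mem _
      · refine C_mem_polyGrading ?_
        have := Hom.β_mem x i j
        rwa [show E'.e i - E.e j = E'.e i + h - a - (E.e j + h - a) by ring] at this)
    (by
      rintro (i | i) (j | j)
      · exact C_mem_polyGrading (Hom.β_mem x i j)
      · exact zero_mem _
      · exact zero_mem _
      · refine C_mem_polyGrading ?_
        have := Hom.α_mem x i j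
        rwa [show E'.d i - E.d j = E'.d i - a - (E.d j - a) by ring] at this)
    (by
      have h1 := congrArg (Matrix.map · Polynomial.C) (Hom.comm_φ x)
      have h2 := congrArg (Matrix.map · Polynomial.C) (Hom.comm_ψ x)
      simp only [Matrix.map_mul] at h1 h2
      refine (Matrix.fromBlocks_multiply ..).trans
        (Eq.trans ?_ (Matrix.fromBlocks_multiply ..).symm)
      simp [h1, h2])
    (by
      have h1 := congrArg (Matrix.map · Polynomial.C) (Hom.comm_φ x)
      have h2 := congrArg (Matrix.map · Polynomial.C) (Hom.comm_ψ x)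
      simp only [Matrix.map_mul] at h1 h2
      refine (Matrix.fromBlocks_multiply ..).trans
        (Eq.trans ?_ (Matrix.fromBlocks_multiply ..).symm)
      simp [h1, h2])

lemma α_pushHom {E E' : MatFac 𝒜 f h} (x : E ⟶ E') : Hom.α (pushHom hF x) =
    Matrix.fromBlocks ((Hom.α x).map Polynomial.C) 0 0 ((Hom.β x).map Polynomial.C) := rfl

lemma β_pushHom {E E' : MatFac 𝒜 f h} (x : E ⟶ E') : Hom.β (pushHom hF x) =
    Matrix.fromBlocks ((Hom.β x).map Polynomial.C) 0 0 ((Hom.α x).map Polynomial.C) := rfl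

/-- The functor `E ↦ Ẽ` on graded matrix factorizations. -/
noncomputable def pushFunctor :
    MatFac 𝒜 f h ⥤ MatFac (polyGrading 𝒜 a) (Polynomial.C f + Polynomial.X * g) h where
  obj E := E.push hF
  map x := pushHom hF x
  map_id E := by
    have h1 : Matrix.fromBlocks ((1 : Matrix E.ι E.ι R).map Polynomial.C) 0 0
        ((1 : Matrix E.ι E.ι R).map Polynomial.C) = 1 := by
      rw [Matrix.map_one _ (map_zero _) (map_one _), Matrix.fromBlocks_one]
    exact Hom.ext h1 h1
  map_comp {E E' E''} x y := by
    have h1 : ∀ (m n : Matrix E'.ι E.ι R) (m' n' : Matrix E''.ι E'.ι R),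
        Matrix.fromBlocks ((m' * m).map Polynomial.C) 0 0 ((n' * n).map Polynomial.C) =
        Matrix.fromBlocks (m'.map Polynomial.C) 0 0 (n'.map Polynomial.C) *
          Matrix.fromBlocks (m.map Polynomial.C) 0 0 (n.map Polynomial.C) := by
      intro m n m' n'
      rw [Matrix.fromBlocks_multiply]
      simp [Matrix.map_mul]
    exact Hom.ext (h1 _ _ _ _) (h1 _ _ _ _)

lemma fromBlocks_diag_sub {ι κ μ ν : Type} {B : Type*} [CommRing B] (m m' : Matrix ι κ B)
    (n n' : Matrix μ ν B) : Matrix.fromBlocks m 0 0 n - Matrix.fromBlocks m' 0 0 n' =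
      Matrix.fromBlocks (m - m') 0 0 (n - n') := by
  rw [sub_eq_add_neg, Matrix.fromBlocks_neg, Matrix.fromBlocks_add]
  simp [sub_eq_add_neg]

/-- A homotopy `(ξ, η)` induces the homotopy `(diag(ξ, η), diag(η, ξ))`. -/
lemma homotopic_pushHom {E E' : MatFac 𝒜 f h} {x y : E ⟶ E'} (hxy : homotopic 𝒜 f h x y) :
    homotopic _ _ h (pushHom hF x) (pushHom hF y) := by
  obtain ⟨ξ, η, hξ, hη, h1, h2⟩ := hxy
  have h1' : (Hom.α x).map Polynomial.C - (Hom.α y).map Polynomial.C =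
      E'.φ.map Polynomial.C * ξ.map Polynomial.C + η.map Polynomial.C * E.ψ.map Polynomial.C := by
    rw [← Matrix.map_mul, ← Matrix.map_mul, ← Matrix.map_add _ (map_add _), ← h1,
      Matrix.map_sub _ (map_sub _)]
  have h2' : (Hom.β x).map Polynomial.C - (Hom.β y).map Polynomial.C =
      E'.ψ.map Polynomial.C * η.map Polynomial.C + ξ.map Polynomial.C * E.φ.map Polynomial.C := by
    rw [← Matrix.map_mul, ← Matrix.map_mul, ← Matrix.map_add _ (map_add _), ← h2,
      Matrix.map_sub _ (map_sub _)]
  refine ⟨Matrix.fromBlocks (ξ.map Polynomial.C) 0 0 (η.map Polynomial.C),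
    Matrix.fromBlocks (η.map Polynomial.C) 0 0 (ξ.map Polynomial.C), ?_, ?_, ?_, ?_⟩
  · rintro (i | i) (j | j)
    · exact C_mem_polyGrading (hξ i j)
    · exact zero_mem _
    · exact zero_mem _
    · refine C_mem_polyGrading ?_
      have := hη i j
      rwa [show E'.d i - h - E.e j = E'.d i - a - (E.e j + h - a) by ring] at this
  · rintro (i | i) (j | j)
    · exact C_mem_polyGrading (hη i j)
    · exact zero_mem _
    · exact zero_mem _
    · refine C_mem_polyGrading ?_
      have := hξ i j
      rwa [show E'.e i - E.d j = E'.e i + h - a - h - (E.d j - a) by ring] at this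
  · rw [α_pushHom, α_pushHom]
    refine (fromBlocks_diag_sub ..).trans (Eq.trans ?_ (congrArg₂ (· + ·)
      (Matrix.fromBlocks_multiply ..) (Matrix.fromBlocks_multiply ..)).symm)
    rw [Matrix.fromBlocks_add, h1', h2']
    congr 1 <;> simp
  · rw [β_pushHom, β_pushHom]
    refine (fromBlocks_diag_sub ..).trans (Eq.trans ?_ (congrArg₂ (· + ·)
      (Matrix.fromBlocks_multiply ..) (Matrix.fromBlocks_multiply ..)).symm)
    rw [Matrix.fromBlocks_add, h1', h2']
    congr 1 <;> simp

end MatFac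

variable (hF : Polynomial.C f + Polynomial.X * g ∈ polyGrading 𝒜 a h) (hf : f ∈ 𝒜 h)

/-- The functor `E ↦ Ẽ` on homotopy categories. -/
noncomputable def pushHmf :
    Hmf 𝒜 f h ⥤ Hmf (polyGrading 𝒜 a) (Polynomial.C f + Polynomial.X * g) h :=
  CategoryTheory.Quotient.lift _ (MatFac.pushFunctor hF ⋙ toHmf _ _ h)
    (fun _ _ _ _ hxy => CategoryTheory.Quotient.sound _ (MatFac.homotopic_pushHom hF hxy))

section Reduction

variable {ι κ μ ν : Type} [Fintype ι] [DecidableEq ι] [Fintype κ] [DecidableEq κ]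
  [Fintype μ] [DecidableEq μ] [Fintype ν] [DecidableEq ν]

/-- The projection to the first summand, followed by the reduction modulo `w`. -/
noncomputable def redFst (d : ι → ℤ) (e : κ → ℤ) :
    freeBar (polyGrading 𝒜 a) hF (Sum.elim d e) ⟶ (pushMod 𝒜 a g).obj (freeBar 𝒜 hf d) :=
  GrModFG.ofLin (M := freeBar (polyGrading 𝒜 a) hF (Sum.elim d e))
    (N := (pushMod 𝒜 a g).obj (freeBar 𝒜 hf d))
    { toFun := fun v i => pr f g (v (Sum.inl i))
      map_add' := fun v w => funext fun i => map_add (pr f g) (v (Sum.inl i)) (w (Sum.inl i))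
      map_smul' := fun c v => funext fun i => map_mul (pr f g) c (v (Sum.inl i)) }
    (fun _ _ hv i => pr_mem 𝒜 a g _ _ (hv (Sum.inl i)))

lemma barMap_comp_redFst {b : ι → ℤ} {b' : κ → ℤ} {c : μ → ℤ} {c' : ν → ℤ}
    (M : Matrix (μ ⊕ ν) (ι ⊕ κ) (Polynomial R))
    (hM : ∀ i j, M i j ∈ polyGrading 𝒜 a (Sum.elim c c' i - Sum.elim b b' j))
    (m : Matrix μ ι R) (hm : ∀ i j, m i j ∈ 𝒜 (c i - b j))
    (h1 : ∀ i j, (M (Sum.inl i) (Sum.inl j)).coeff 0 = m i j)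
    (h2 : ∀ i j, (M (Sum.inl i) (Sum.inr j)).coeff 0 = 0) :
    barMap (polyGrading 𝒜 a) hF M hM ≫ redFst hF hf c c' =
      redFst hF hf b b' ≫ (pushMod 𝒜 a g).map (barMap 𝒜 hf m hm) := by
  refine GrModFG.hom_ext fun v => funext fun i => ?_
  change pr f g (∑ j, Ideal.Quotient.mk _ (M (Sum.inl i) j) *
      (v : ι ⊕ κ → Polynomial R ⧸ Ideal.span {Polynomial.C f + Polynomial.X * g}) j) =
    ∑ j, Ideal.Quotient.mk _ (m i j) * pr f g
      ((v : ι ⊕ κ → Polynomial R ⧸ Ideal.span {Polynomial.C f + Polynomial.X * g}) (Sum.inl j))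
  rw [map_sum, Fintype.sum_sum_type]
  simp only [map_mul, pr_mk, h1, h2, map_zero, zero_mul, Finset.sum_const_zero, add_zero]

end Reduction

/-- The projection of `M̃₀` to the cokernel of `φ̃`. -/
noncomputable def pushPi (E : MatFac 𝒜 f h) :
    freeBar (polyGrading 𝒜 a) hF (Sum.elim E.d (fun i => E.e i + h - a)) ⟶
      (cokerFunctor (polyGrading 𝒜 a) hF).obj (E.push hF) :=
  cokerPi hF (E.push hF)

instance (E : MatFac 𝒜 f h) : Epi (pushPi hF E) :=
  inferInstanceAs (Epi (cokerPi hF (E.push hF)))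

/-- The morphism `M̃₁ → M̃₀` modulo `F`. -/
noncomputable def pushBar (E : MatFac 𝒜 f h) :
    freeBar (polyGrading 𝒜 a) hF (Sum.elim E.e (fun i => E.d i - a)) ⟶
      freeBar (polyGrading 𝒜 a) hF (Sum.elim E.d (fun i => E.e i + h - a)) :=
  barMap (polyGrading 𝒜 a) hF (E.push hF).φ (E.push hF).φ_mem

lemma pushBar_comp_pushPi (E : MatFac 𝒜 f h) : pushBar hF E ≫ pushPi hF E = 0 :=
  barMap_comp_cokerPi hF (E.push hF)

lemma pushBar_comp_redFst (E : MatFac 𝒜 f h) :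
    pushBar hF E ≫ redFst hF hf E.d (fun i => E.e i + h - a) =
      redFst hF hf E.e (fun i => E.d i - a) ≫ (pushMod 𝒜 a g).map (barMap 𝒜 hf E.φ E.φ_mem) :=
  barMap_comp_redFst hF hf (E.push hF).φ (E.push hF).φ_mem E.φ E.φ_mem
    (fun i j => by simp [MatFac.push]) (fun i j => by simp [MatFac.push])

/-- The natural epimorphism from the cokernel of `φ̃` to the push-forward of the cokernel of `φ`. -/
noncomputable def cokerPush (E : MatFac 𝒜 f h) :
    (cokerFunctor (polyGrading 𝒜 a) hF).obj (E.push hF) ⟶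
      (pushMod 𝒜 a g).obj ((cokerFunctor 𝒜 hf).obj E) :=
  cokerDesc hF (E.push hF)
    (redFst hF hf E.d (fun i => E.e i + h - a) ≫ (pushMod 𝒜 a g).map (cokerPi hf E)) (by
      have h0 : pushBar hF E ≫ redFst hF hf E.d (fun i => E.e i + h - a) ≫
          (pushMod 𝒜 a g).map (cokerPi hf E) = 0 := by
        rw [← Category.assoc, pushBar_comp_redFst, Category.assoc, ← Functor.map_comp,
          barMap_comp_cokerPi, Functor.map_zero, comp_zero]
      exact h0)

lemma pushPi_comp_cokerPush (E : MatFac 𝒜 f h) :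
    pushPi hF E ≫ cokerPush hF hf E =
      redFst hF hf E.d (fun i => E.e i + h - a) ≫ (pushMod 𝒜 a g).map (cokerPi hf E) :=
  cokerPi_desc _ _ _ _

/-- The epimorphisms `coker φ̃ → coker φ` are natural. -/
noncomputable def cokerPushNatTrans (hF : Polynomial.C f + Polynomial.X * g ∈ polyGrading 𝒜 a h)
    (hf : f ∈ 𝒜 h) :
    MatFac.pushFunctor hF ⋙ cokerFunctor (polyGrading 𝒜 a) hF ⟶
      cokerFunctor 𝒜 hf ⋙ pushMod 𝒜 a g where
  app E := cokerPush hF hf E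
  naturality E E' x := by
    let m : freeBar (polyGrading 𝒜 a) hF (Sum.elim E.d (fun i => E.e i + h - a)) ⟶
        freeBar (polyGrading 𝒜 a) hF (Sum.elim E'.d (fun i => E'.e i + h - a)) :=
      barMap (polyGrading 𝒜 a) hF (MatFac.Hom.α (MatFac.pushHom hF x))
        (MatFac.Hom.α_mem (MatFac.pushHom hF x))
    have h0 : m ≫ redFst hF hf E'.d (fun i => E'.e i + h - a) =
        redFst hF hf E.d (fun i => E.e i + h - a) ≫
          (pushMod 𝒜 a g).map (barMap 𝒜 hf (MatFac.Hom.α x) (MatFac.Hom.α_mem x)) :=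
      barMap_comp_redFst hF hf _ _ _ _
        (fun i j => by simp [MatFac.α_pushHom]) (fun i j => by simp [MatFac.α_pushHom])
    have h1 : pushPi hF E ≫ (cokerFunctor (polyGrading 𝒜 a) hF).map
        (MatFac.pushHom hF x) = m ≫ pushPi hF E' := cokerPi_map hF _
    refine (cancel_epi (pushPi hF E)).1 ?_
    have h2 : pushPi hF E ≫ (cokerFunctor (polyGrading 𝒜 a) hF).map (MatFac.pushHom hF x) ≫
        cokerPush hF hf E' = pushPi hF E ≫ cokerPush hF hf E ≫
          (pushMod 𝒜 a g).map ((cokerFunctor 𝒜 hf).map x) := by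
      rw [← Category.assoc, h1, Category.assoc, pushPi_comp_cokerPush, ← Category.assoc, h0,
        ← Category.assoc, pushPi_comp_cokerPush, Category.assoc, Category.assoc,
        ← Functor.map_comp, ← Functor.map_comp, cokerPi_map]
    exact h2

/-- The inclusion of the second summand of `M̃₀` modulo `F`. -/
noncomputable def pushInr (E : MatFac 𝒜 f h) :
    freeBar (polyGrading 𝒜 a) hF (fun i => E.e i + h - a) ⟶
      freeBar (polyGrading 𝒜 a) hF (Sum.elim E.d (fun i => E.e i + h - a)) :=
  GrModFG.ofLin (M := freeBar (polyGrading 𝒜 a) hF (fun i => E.e i + h - a))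
    (N := freeBar (polyGrading 𝒜 a) hF (Sum.elim E.d (fun i => E.e i + h - a)))
    { toFun := fun v => Sum.elim 0 v
      map_add' := fun v w => funext fun i => by
        cases i
        · exact (add_zero _).symm
        · rfl
      map_smul' := fun c v => funext fun i => by
        cases i
        · exact (mul_zero _).symm
        · rfl }
    (by
      rintro n v hv (i | i)
      · exact zero_mem _
      · exact hv i)

lemma pushInr_comp_cokerPush (E : MatFac 𝒜 f h) :
    (pushInr hF E ≫ pushPi hF E) ≫ cokerPush hF hf E = 0 := by
  have h0 : pushInr hF E ≫ redFst hF hf E.d (fun i => E.e i + h - a) = 0 :=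
    GrModFG.hom_ext fun v => funext fun i => map_zero (pr f g)
  rw [Category.assoc, pushPi_comp_cokerPush, ← Category.assoc, h0, zero_comp]

lemma lin_pushBar (E : MatFac 𝒜 f h) (x z : E.ι → Polynomial R) :
    GrModFG.lin (pushBar hF E) (fun i => Ideal.Quotient.mk _ (Sum.elim x z i)) =
      fun i => Ideal.Quotient.mk _ (Sum.elim
        ((E.φ.map Polynomial.C).mulVec x + (Polynomial.X : Polynomial R) • z)
        (-(g • x) + (E.ψ.map Polynomial.C).mulVec z) i) := by
  refine Eq.trans ?_ (funext fun i => congrArg (Ideal.Quotient.mk _) (congrFun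
    (a := i) ((Matrix.fromBlocks_mulVec (E.φ.map Polynomial.C)
      ((Polynomial.X : Polynomial R) • (1 : Matrix E.ι E.ι (Polynomial R)))
      (-(g • (1 : Matrix E.ι E.ι (Polynomial R)))) (E.ψ.map Polynomial.C)
      (Sum.elim x z)).trans ?_)))
  · exact funext fun i => (RingHom.map_mulVec (Ideal.Quotient.mk
      (Ideal.span {Polynomial.C f + Polynomial.X * g})) (E.push hF).φ (Sum.elim x z) i).symm
  · simp [Matrix.smul_mulVec, Matrix.neg_mulVec, Function.comp_def]

variable [IsNoetherianRing R]

/-- The kernel of `coker φ̃ → coker φ` is the second summand of `M̃₀` modulo `F`. -/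
lemma shortExact_cokerPush (hf0 : f ∈ nonZeroDivisors R) (E : MatFac 𝒜 f h) :
    (ShortComplex.mk _ _ (pushInr_comp_cokerPush hF hf E)).ShortExact := by
  have hinj : Function.Injective (GrModFG.lin (pushInr hF E ≫ pushPi hF E)) := by
    rw [injective_iff_map_eq_zero]
    intro y hy
    obtain ⟨z, hz⟩ : ∃ z, GrModFG.lin (pushBar hF E) z = GrModFG.lin (pushInr hF E) y :=
      exists_of_cokerPi_eq_zero hF (E.push hF) hy
    obtain ⟨v, rfl⟩ := exists_mk_eq _ z
    obtain ⟨x, z, rfl⟩ : ∃ x z, v = Sum.elim x z := ⟨_, _, (Sum.elim_comp_inl_inr v).symm⟩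
    have hz' := (lin_pushBar hF E x z).symm.trans hz
    have h1 : ∀ i, ∃ u, ((E.φ.map Polynomial.C).mulVec x + (Polynomial.X : Polynomial R) • z) i =
        (Polynomial.C f + Polynomial.X * g) * u := by
      intro i
      rw [← dvd_def, ← Ideal.mem_span_singleton, ← Ideal.Quotient.eq_zero_iff_mem]
      exact congrFun hz' (Sum.inl i)
    choose u hu using h1
    obtain ⟨q, hq⟩ := exists_of_mulVec_eq hf0 E x z u (funext hu)
    funext i
    refine (congrFun hz' (Sum.inr i)).symm.trans ?_
    refine Ideal.Quotient.eq_zero_iff_mem.2 (Ideal.mem_span_singleton.2 ⟨q i, ?_⟩)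
    exact congrFun hq i
  have hπ : ∀ v, GrModFG.lin (cokerPush hF hf E) (GrModFG.lin (pushPi hF E) v) =
      GrModFG.lin (cokerPi hf E) (GrModFG.lin (redFst hF hf E.d (fun i => E.e i + h - a)) v) :=
    fun v => LinearMap.congr_fun (congrArg GrModFG.lin (pushPi_comp_cokerPush hF hf E)) v
  refine
    { exact := ShortComplex.exact_of_f_is_kernel _
        (GrModFG.isLimitOfExact _ _ _ hinj fun x hx => ?_)
      mono_f := GrModFG.mono_of_injective _ hinj
      epi_g := GrModFG.epi_of_surjective _ fun y => ?_ }
  · obtain ⟨v, rfl⟩ : ∃ v, GrModFG.lin (pushPi hF E) v = x := cokerPi_surjective hF (E.push hF) x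
    obtain ⟨v, rfl⟩ := exists_mk_eq _ v
    obtain ⟨p, q, rfl⟩ : ∃ p q, v = Sum.elim p q := ⟨_, _, (Sum.elim_comp_inl_inr v).symm⟩
    obtain ⟨r, hr⟩ := exists_of_cokerPi_eq_zero hf E ((hπ _).symm.trans hx)
    obtain ⟨r, rfl⟩ := exists_mk_eq _ r
    have h1 : ∀ i, ∃ s, (p i).coeff 0 - E.φ.mulVec r i = f * s := by
      intro i
      rw [← dvd_def, ← Ideal.mem_span_singleton, ← Ideal.Quotient.eq]
      exact (congrFun hr i).symm.trans
        (RingHom.map_mulVec (Ideal.Quotient.mk (Ideal.span {f})) E.φ r i).symm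
    choose s hs using h1
    -- The constant coefficient of `p` is a value of `φ`.
    have h2 : ∀ i, ∃ t, p i - (E.φ.map Polynomial.C).mulVec
        (fun j => Polynomial.C ((r + E.ψ.mulVec s) j)) i = Polynomial.X * t := by
      intro i
      have h3 : (E.φ.map Polynomial.C).mulVec (fun j => Polynomial.C ((r + E.ψ.mulVec s) j)) i =
          Polynomial.C (E.φ.mulVec (r + E.ψ.mulVec s) i) :=
        (RingHom.map_mulVec Polynomial.C E.φ _ i).symm
      rw [← dvd_def, Polynomial.X_dvd_iff, h3, Matrix.mulVec_add, Matrix.mulVec_mulVec, E.φ_mul_ψ,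
        Matrix.smul_mulVec, Matrix.one_mulVec]
      have := hs i
      simp only [Polynomial.coeff_sub, Polynomial.coeff_C_zero, Pi.add_apply, Pi.smul_apply,
        smul_eq_mul]
      linear_combination this
    choose t ht using h2
    set x0 : E.ι → Polynomial R := fun j => Polynomial.C ((r + E.ψ.mulVec s) j) with hx0
    have hp : p = (E.φ.map Polynomial.C).mulVec x0 + (Polynomial.X : Polynomial R) • t := by
      rw [← sub_eq_iff_eq_add']
      exact funext ht
    -- Subtracting `φ̃ (x0, t)` clears the first component.
    refine ⟨fun i => Ideal.Quotient.mk _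
      ((q - (-(g • x0) + (E.ψ.map Polynomial.C).mulVec t)) i), ?_⟩
    have h3 : GrModFG.lin (pushPi hF E) (GrModFG.lin (pushBar hF E)
        (fun i => Ideal.Quotient.mk _ (Sum.elim x0 t i))) = 0 :=
      LinearMap.congr_fun (congrArg GrModFG.lin (pushBar_comp_pushPi hF E)) _
    rw [lin_pushBar] at h3
    refine Eq.trans ?_ (sub_zero _)
    rw [← h3]
    refine Eq.trans ?_ (map_sub (GrModFG.lin (pushPi hF E)) _ _)
    refine congrArg (GrModFG.lin (pushPi hF E)) (funext fun i => ?_)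
    cases i with
    | inl i =>
      refine (sub_self (Ideal.Quotient.mk _ (p i))).symm.trans ?_
      exact congrArg (fun y => Ideal.Quotient.mk _ (p i) - Ideal.Quotient.mk _ y) (congrFun hp i)
    | inr i => exact map_sub (Ideal.Quotient.mk _) (q i) _
  · obtain ⟨v, rfl⟩ := cokerPi_surjective hf E y
    refine ⟨GrModFG.lin (pushPi hF E) (Sum.elim (fun i => (pr_surjective g
      ((v : E.ι → R ⧸ Ideal.span {f}) i)).choose) 0), (hπ _).trans ?_⟩
    exact congrArg (GrModFG.lin (cokerPi hf E)) (funext fun i => (pr_surjective g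
      ((v : E.ι → R ⧸ Ideal.span {f}) i)).choose_spec)

end PushForward

/-! ### Comparison with the push-forward of singularity categories -/

section Comparison

/-- `F = f + w g` is a non-zero-divisor of `R[w]`. -/
lemma C_add_X_mul_mem_nonZeroDivisors {R : Type u} [CommRing R] {f : R}
    (g : Polynomial R) (hf0 : f ∈ nonZeroDivisors R) :
    Polynomial.C f + Polynomial.X * g ∈ nonZeroDivisors (Polynomial R) :=
  Polynomial.mem_nonzeroDivisors_of_coeff_mem 0 (by simpa using hf0)

variable {R : Type u} [CommRing R] [IsNoetherianRing R] {𝒜 : ℤ → AddSubgroup R} [GradedRing 𝒜]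
  {f : R} {h : ℤ} {a : ℤ} {g : Polynomial R}
  (hF : Polynomial.C f + Polynomial.X * g ∈ polyGrading 𝒜 a h) (hf : f ∈ 𝒜 h)
  (hf0 : f ∈ nonZeroDivisors R)

/-- The push-forward functor is induced by the exact functor `pushMod`. -/
noncomputable def toDsingCompPushSing :
    toDsing (GrModFG (quotGrading 𝒜 f)) ⋙ pushSing 𝒜 a g hf hF hf0 ≅
      mapDb (pushMod 𝒜 a g) ⋙ toDsing _ :=
  have : EnoughProjectives
      (GrModFG (quotGrading (polyGrading 𝒜 a) (Polynomial.C f + Polynomial.X * g))) :=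
    GrModFG.enoughProjectives (isInternal_quotGrading (polyGrading 𝒜 a)
      (DirectSum.Decomposition.isInternal _) hF)
  Localization.fac (mapDb (pushMod 𝒜 a g) ⋙ toDsing _)
    (mapDb_inverts (pushMod 𝒜 a g) (hasProjectiveDimensionLT_pushMod hf hF hf0)) (toDsing _)

lemma isIso_whiskerRight_cokerPushNatTrans (hf0 : f ∈ nonZeroDivisors R) :
    IsIso (Functor.whiskerRight (cokerPushNatTrans hF hf) (singleDb _ ⋙ toDsing _)) := by
  have (E : MatFac 𝒜 f h) : IsIso ((Functor.whiskerRight (cokerPushNatTrans hF hf)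
      (singleDb _ ⋙ toDsing _)).app E) :=
    have : Projective (ShortComplex.mk _ _ (pushInr_comp_cokerPush hF hf E)).X₁ :=
      inferInstanceAs (Projective (freeBar (polyGrading 𝒜 a) hF (fun i => E.e i + h - a)))
    isIso_toDsing_map (shortExact_cokerPush hF hf hf0 E)
  exact NatIso.isIso_of_isIso_app _

/-- The functor `E ↦ Ẽ` corresponds to the push-forward of singularity categories. -/
noncomputable def pushHmfCompStab :
    pushHmf hF ⋙ stab (polyGrading 𝒜 a) hF ≅ stab 𝒜 hf ⋙ pushSing 𝒜 a g hf hF hf0 :=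
  have := isIso_whiskerRight_cokerPushNatTrans hF hf hf0
  CategoryTheory.Quotient.natIsoLift _
    (show MatFac.pushFunctor hF ⋙ cokerFunctor (polyGrading 𝒜 a) hF ⋙ singleDb _ ⋙ toDsing _ ≅
        cokerFunctor 𝒜 hf ⋙ singleDb _ ⋙ toDsing _ ⋙ pushSing 𝒜 a g hf hF hf0 from
      asIso (Functor.whiskerRight (cokerPushNatTrans hF hf) (singleDb _ ⋙ toDsing _)) ≪≫
      Functor.isoWhiskerLeft (cokerFunctor 𝒜 hf)
        (Functor.isoWhiskerRight (singleDbCompMapDb (pushMod 𝒜 a g)).symm (toDsing _) ≪≫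
          Functor.isoWhiskerLeft (singleDb _) (toDsingCompPushSing hF hf hf0).symm))

end Comparison

end GrMF

theorem proposition3p1 {R : Type u} [CommRing R] [IsNoetherianRing R]
    (𝒜 : ℤ → AddSubgroup R) [GradedRing 𝒜] (f : R) (h : ℤ) (hf : f ∈ 𝒜 h)
    (hf0 : f ∈ nonZeroDivisors R) (a : ℤ) (g : Polynomial R)
    (hg : Polynomial.X ∣ g) (hF : Polynomial.C f + Polynomial.X * g ∈ polyGrading 𝒜 a h) :
    (∃ Φ : Hmf 𝒜 f h ⥤ Hmf (polyGrading 𝒜 a) (Polynomial.C f + Polynomial.X * g) h,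
      Nonempty (Φ ⋙ stab (polyGrading 𝒜 a) hF ≅ stab 𝒜 hf ⋙ pushSing 𝒜 a g hf hF hf0) ∧
      ∀ E : MatFac 𝒜 f h, Φ.obj ((toHmf 𝒜 f h).obj E) = (toHmf _ _ h).obj (E.push hF)) ∧
    (∀ Φ : Hmf 𝒜 f h ⥤ Hmf (polyGrading 𝒜 a) (Polynomial.C f + Polynomial.X * g) h,
      Nonempty (Φ ⋙ stab (polyGrading 𝒜 a) hF ≅ stab 𝒜 hf ⋙ pushSing 𝒜 a g hf hF hf0) →
      ∀ E : MatFac 𝒜 f h,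
        Nonempty (Φ.obj ((toHmf 𝒜 f h).obj E) ≅ (toHmf _ _ h).obj (E.push hF))) := by
  refine ⟨⟨pushHmf hF, ⟨pushHmfCompStab hF hf hf0⟩, fun E => rfl⟩, ?_⟩
  rintro Φ ⟨e⟩ E
  have := stab_full hF (C_add_X_mul_mem_nonZeroDivisors g hf0)
  have := stab_faithful hF (C_add_X_mul_mem_nonZeroDivisors g hf0)
  exact ⟨(stab (polyGrading 𝒜 a) hF).preimageIso
    ((e ≪≫ (pushHmfCompStab hF hf hf0).symm).app ((toHmf 𝒜 f h).obj E))⟩
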